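/- Let $\mathcal M$ be a compact smooth manifold (without boundary) of dimension $2m$ with a smooth pseudo-Riemannian metric $g^{PR}$ of signature $(n,2m-n)$ ($n$ plus signs), where $n$ is odd and $0<n<2m$. Let $r$ be a spacelike reflection, i.e. a smooth $g^{PR}$-isometric automorphism of $T\mathcal M$ with $r^2=1$ such that $g^{R}:=g^{PR}(\cdot,r\,\cdot)$ is a Riemannian metric; $T\mathcal M=T\mathcal M^+\oplus T\mathcal M^-$ is the splitting into the $\pm1$-eigenbundles of $r$, both assumed oriented. Let $S\to\mathcal M$ be a Hermitian spinor bundle of rank $2^m$ for both metrics: it is given by a spin structure over oriented local frames $(E_1,\dots,E_{2m})$ of $T\mathcal M$ that are orthonormal for both metrics, with $E_1,\dots,E_n\in T\mathcal M^+$ and $E_{n+1},\dots,E_{2m}\in T\mathcal M^-$. In the corresponding spin frames the Clifford actions are given by unitary gamma matrices $\gamma_R^a$, $\gamma_{PR}^a$ of size $2^m$ with $\{\gamma_R^a,\gamma_R^b\}=2\delta^{ab}$ and $\{\gamma_{PR}^a,\gamma_{PR}^b\}=2\eta^{ab}$, $\eta=\mathrm{diag}(1,\dots,1,-1,\dots,-1)$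 ($n$ plus signs), chosen so that the gradings agree: $\Gamma:=i^{m}\gamma_R^1\cdots\gamma_R^{2m}=i^{-m(2m-1)-n}\gamma_{PR}^1\cdots\gamma_{PR}^{2m}$. Let $\nabla^{R,S}$, $\nabla^{PR,S}$ be the spin connections on $S$ induced by the Levi-Civita connections of $g^R$ and $g^{PR}$, and $\mathcal H=L^2(\mathcal M,S)$ (for the Riemannian volume of $g^R$). Put $$D_{(1)}=-i\gamma_R^a\nabla_a^{R,S},\quad D^{K_{(2)}}=-i\gamma_{PR}^a\nabla_a^{PR,S},\quad K_{(1)}=i^{-n(n-1)/2}\gamma_R^1\cdots\gamma_R^n,\quad K_{(2)}=i^{-n(n-1)/2}\gamma_{PR}^1\cdots\gamma_{PR}^n,$$ and let $\hat D^{K_{(1)}}=K_{(1)}D_{(1)}$ and $\hat D_{(2)}=K_{(2)}D^{K_{(2)}}$ be the dual operators. Let $\mathcal A=C^\infty(\mathcal M)\otimes\mathbb C^2$, with elements $a=(f,g)$ ($f,g$ smooth complex functions), act on spinors by $\pi(f,g)=f\,\tfrac{1+\Gamma}{2}+g\,\tfrac{1-\Gamma}{2}$, and let $\rho(f,g)=(g,f)$.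 For an operator $T$ write $[T,a]=T\pi(a)-\pi(a)T$ and $[T,a]_\rho=T\pi(a)-\pi(\rho(a))T$. All these operators have as domain the space of smooth sections of $S$, which is dense in $\mathcal H$, and "bounded" means bounded for the norm of $\mathcal H$ on this domain. Then: 1. for every $a\in\mathcal A$, the operators $[\hat D_{(2)},a]$, $[\hat D^{K_{(1)}},a]$, $[D^{K_{(2)}},a]_\rho$ and $[D_{(1)},a]_\rho$ are bounded; 2. for every $a\in\mathcal A$ with $\rho(a)\ne a$, each of the operators $[\hat D_{(2)},a]_\rho$, $[\hat D^{K_{(1)}},a]_\rho$, $[D^{K_{(2)}},a]$ and $[D_{(1)},a]$ is unbounded; 3. for every $a\in\mathcal A$ with $\rho(a)=a$, the operators $[\hat D_{(2)},a]_\rho$, $[\hat D^{K_{(1)}},a]_\rho$, $[D^{K_{(2)}},a]$ and $[D_{(1)},a]$ are bounded. -/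

import Mathlib

open scoped Manifold ContDiff Matrix ENNReal NNReal
open MeasureTheory

noncomputable section

namespace KreinDirac

/-- The model space `ℝ^{2m}` of the manifold. -/
abbrev Model (m : ℕ) : Type := EuclideanSpace ℝ (Fin (2 * m))

/-- The typical fibre `ℂ^{2^m}` of the spinor bundle, with its standard Hermitian product. -/
abbrev SpinorSpace (m : ℕ) : Type := EuclideanSpace ℂ (Fin (2 ^ m))

/-- Endomorphisms of the typical spinor fibre. -/
abbrev SpinorMatrix (m : ℕ) : Type := Matrix (Fin (2 ^ m)) (Fin (2 ^ m)) ℂ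

/-- The action of a matrix on the typical spinor fibre. -/
def act {m : ℕ} (A : SpinorMatrix m) (v : SpinorSpace m) : SpinorSpace m :=
  Matrix.toEuclideanLin A v

/-! ### Clifford algebra -/

/-- The signs `g(E_a, E_a)` of an orthonormal frame of a Riemannian metric. -/
def signR (m : ℕ) : Fin (2 * m) → ℝ := fun _ => 1

/-- The signs `g(E_a, E_a)` of an orthonormal frame of a metric with `n` plus signs followed by
`2m - n` minus signs. -/
def signPR (m n : ℕ) : Fin (2 * m) → ℝ := fun a => if a.val < n then 1 else -1

/-- Unitary gamma matrices `γ^a` of size `2^m` for the diagonal metric with entries `ε`: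
`{γ^a, γ^b} = 2 g^{ab}`. -/
structure GammaMatrices (m : ℕ) (ε : Fin (2 * m) → ℝ) where
  γ : Fin (2 * m) → SpinorMatrix m
  unitary : ∀ a, γ a ∈ Matrix.unitaryGroup (Fin (2 ^ m)) ℂ
  clifford : ∀ a b,
    γ a * γ b + γ b * γ a = if a = b then ((2 * ε a : ℝ) : ℂ) • (1 : SpinorMatrix m) else 0

/-- `γ(u) = ∑_a u_a γ^a` for a real covector `u`. -/
def GammaMatrices.slash {m : ℕ} {ε : Fin (2 * m) → ℝ} (G : GammaMatrices m ε)
    (u : Fin (2 * m) → ℝ) : SpinorMatrix m :=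
  ∑ a, (u a : ℂ) • G.γ a

/-- The (matrix) spin group: all products of an even number of `γ(u)` with `g(u, u) = ±1`. -/
def GammaMatrices.spinGroup {m : ℕ} {ε : Fin (2 * m) → ℝ} (G : GammaMatrices m ε) :
    Submonoid (SpinorMatrix m) :=
  Submonoid.closure {A | ∃ u v : Fin (2 * m) → ℝ,
    |∑ a, ε a * u a ^ 2| = 1 ∧ |∑ a, ε a * v a ^ 2| = 1 ∧ A = G.slash u * G.slash v}

/-- The Riemannian grading `Γ_R = i^m γ^1 ⋯ γ^{2m}`. -/
def gradingR {m : ℕ} (G : GammaMatrices m (signR m)) : SpinorMatrix m :=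
  Complex.I ^ m • (List.ofFn G.γ).prod

/-- The pseudo-Riemannian grading `Γ_PR = i^{-m(2m-1)-n} γ^1 ⋯ γ^{2m}`. -/
def gradingPR {m n : ℕ} (G : GammaMatrices m (signPR m n)) : SpinorMatrix m :=
  Complex.I ^ (-((m : ℤ) * (2 * m - 1)) - n) • (List.ofFn G.γ).prod

/-- The fundamental symmetry `i^{-n(n-1)/2} γ^1 ⋯ γ^n`. -/
def fundSymm {m : ℕ} {ε : Fin (2 * m) → ℝ} (n : ℕ) (G : GammaMatrices m ε) : SpinorMatrix m :=
  Complex.I ^ (-((n : ℤ) * (n - 1) / 2)) • ((List.ofFn G.γ).take n).prod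

/-! ### Metrics -/

section Metric

variable (m : ℕ) (M : Type*) [TopologicalSpace M] [ChartedSpace (Model m) M]

/-- A smooth pseudo-Riemannian metric on `M`. -/
structure PseudoRiemannianMetric [IsManifold (𝓡 (2 * m)) ∞ M] where
  inner (x : M) : TangentSpace (𝓡 (2 * m)) x →L[ℝ] TangentSpace (𝓡 (2 * m)) x →L[ℝ] ℝ
  symm (x : M) (v w : TangentSpace (𝓡 (2 * m)) x) : inner x v w = inner x w v
  nondegenerate (x : M) (v : TangentSpace (𝓡 (2 * m)) x) (hv : ∀ w, inner x v w = 0) : v = 0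
  contMDiff : ContMDiff (𝓡 (2 * m)) ((𝓡 (2 * m)).prod 𝓘(ℝ, Model m →L[ℝ] Model m →L[ℝ] ℝ)) ∞
    (fun x => Bundle.TotalSpace.mk' (Model m →L[ℝ] Model m →L[ℝ] ℝ)
      (E := fun x : M => TangentSpace (𝓡 (2 * m)) x →L[ℝ] TangentSpace (𝓡 (2 * m)) x →L[ℝ] ℝ)
      x (inner x))

variable {m M}

/-- A spacelike reflection for `g`: a smooth isometric involution `r` of `TM` such that
`g(·, r ·)` is positive definite. -/
structure SpacelikeReflection [IsManifold (𝓡 (2 * m)) ∞ M] (g : PseudoRiemannianMetric m M) where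
  r (x : M) : TangentSpace (𝓡 (2 * m)) x →L[ℝ] TangentSpace (𝓡 (2 * m)) x
  involutive (x : M) (v : TangentSpace (𝓡 (2 * m)) x) : r x (r x v) = v
  isometric (x : M) (v w : TangentSpace (𝓡 (2 * m)) x) :
    g.inner x (r x v) (r x w) = g.inner x v w
  pos (x : M) (v : TangentSpace (𝓡 (2 * m)) x) (hv : v ≠ 0) : 0 < g.inner x v (r x v)
  contMDiff : ContMDiff (𝓡 (2 * m)) ((𝓡 (2 * m)).prod 𝓘(ℝ, Model m →L[ℝ] Model m)) ∞
    (fun x => Bundle.TotalSpace.mk' (Model m →L[ℝ] Model m)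
      (E := fun x : M => TangentSpace (𝓡 (2 * m)) x →L[ℝ] TangentSpace (𝓡 (2 * m)) x)
      x (r x))

/-- A family of bilinear forms on the tangent spaces, seen as plain functions. -/
abbrev TangentForm (m : ℕ) (M : Type*) [TopologicalSpace M] [ChartedSpace (Model m) M] :=
  (x : M) → TangentSpace (𝓡 (2 * m)) x → TangentSpace (𝓡 (2 * m)) x → ℝ

/-- The `k`-th coordinate vector field of the chart at `x₀`, at the point with coordinates `y`. -/
def coordVector (x₀ : M) (k : Fin (2 * m)) (y : Model m) :
    TangentSpace (𝓡 (2 * m)) ((chartAt (Model m) x₀).symm y) :=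
  mfderiv 𝓘(ℝ, Model m) (𝓡 (2 * m)) (chartAt (Model m) x₀).symm y
    (EuclideanSpace.single k (1 : ℝ) : Model m)

/-- The density `√(det g_{kl})` in the chart at `x₀`. -/
def volumeDensity (q : TangentForm m M) (x₀ : M) (y : Model m) : ℝ≥0∞ :=
  ENNReal.ofReal (Real.sqrt (Matrix.det (Matrix.of fun k l : Fin (2 * m) =>
    q ((chartAt (Model m) x₀).symm y) (coordVector x₀ k y) (coordVector x₀ l y))))

/-- A smooth partition of unity on `M` subordinate to the domains of the charts. -/
def chartPartition (m : ℕ) (M : Type*) [TopologicalSpace M] [ChartedSpace (Model m) M]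
    [IsManifold (𝓡 (2 * m)) ∞ M] [CompactSpace M] [T2Space M] :
    SmoothPartitionOfUnity M (𝓡 (2 * m)) M Set.univ :=
  (SmoothPartitionOfUnity.exists_isSubordinate_chartAt_source (𝓡 (2 * m)) M).choose

/-- The Riemannian volume measure of the metric `q`: the measure with density `√(det g_{kl})` in
each chart, the charts being glued by a partition of unity. -/
def riemannianVolume [IsManifold (𝓡 (2 * m)) ∞ M] [CompactSpace M] [T2Space M]
    [MeasurableSpace M] [BorelSpace M] (q : TangentForm m M) : Measure M :=
  Measure.sum fun x₀ : M =>
    (((volume.restrict (chartAt (Model m) x₀).target).withDensity (volumeDensity q x₀)).map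
      (chartAt (Model m) x₀).symm).withDensity
        (fun x => ENNReal.ofReal (chartPartition m M x₀ x))

end Metric

/-! ### Spin manifolds with a spacelike reflection -/

/-- A manifold of dimension `2m` with a pseudo-Riemannian metric `g_PR` of signature `(n, 2m - n)`,
a spacelike reflection `r`, the Riemannian metric `g_R = g_PR(·, r ·)`, and a spinor bundle for
both metrics. The spin structure is given by an open cover `U_i`, oriented frames
`E^i = (E_1, …, E_{2m})` on `U_i` that are orthonormal for both metrics and adapted to
`TM = TM⁺ ⊕ TM⁻`, and a cocycle of lifts `s_{ij}` to the spin group of the changes of frame.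
The spinor bundle is obtained by gluing the `U_i × ℂ^{2^m}` along the `s_{ij}`. -/
structure KreinSpinManifold (m n : ℕ) (M : Type*) [TopologicalSpace M]
    [ChartedSpace (Model m) M] [IsManifold (𝓡 (2 * m)) ∞ M] (ι : Type*) where
  /-- the metric `g_PR` -/
  metric : PseudoRiemannianMetric m M
  /-- the spacelike reflection -/
  refl : SpacelikeReflection metric
  /-- the matrices `γ_R^a` of the Riemannian Clifford action -/
  gammaR : GammaMatrices m (signR m)
  /-- the matrices `γ_PR^a` of the pseudo-Riemannian Clifford action -/
  gammaPR : GammaMatrices m (signPR m n)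
  grading_eq : gradingR gammaR = gradingPR gammaPR
  U : ι → Set M
  isOpen_U : ∀ i, IsOpen (U i)
  cover : ∀ x, ∃ i, x ∈ U i
  frame : ι → Fin (2 * m) → (x : M) → TangentSpace (𝓡 (2 * m)) x
  frame_smooth : ∀ i a, ContMDiffOn (𝓡 (2 * m)) (𝓡 (2 * m)).tangent ∞
    (fun x => (⟨x, frame i a x⟩ : TangentBundle (𝓡 (2 * m)) M)) (U i)
  frame_orthonormal : ∀ i, ∀ x ∈ U i, ∀ a b,
    metric.inner x (frame i a x) (frame i b x) = if a = b then signPR m n a else 0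
  frame_adapted : ∀ i, ∀ x ∈ U i, ∀ a,
    refl.r x (frame i a x) = signPR m n a • frame i a x
  /-- the frames of `TM⁺` and of `TM⁻` are oriented -/
  frame_oriented : ∀ i j, ∀ x ∈ U i ∩ U j,
    0 < ((Matrix.of fun b a : Fin (2 * m) =>
      metric.inner x (frame i b x) (refl.r x (frame j a x))).toSquareBlockProp
        (fun a => a.val < n)).det ∧
    0 < ((Matrix.of fun b a : Fin (2 * m) =>
      metric.inner x (frame i b x) (refl.r x (frame j a x))).toSquareBlockProp
        (fun a => ¬ a.val < n)).det
  /-- the transition functions `s_{ij}` of the spinor bundle -/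
  trans : ι → ι → M → SpinorMatrix m
  trans_smooth : ∀ i j k l,
    ContMDiffOn (𝓡 (2 * m)) 𝓘(ℝ, ℂ) ∞ (fun x => trans i j x k l) (U i ∩ U j)
  trans_self : ∀ i, ∀ x ∈ U i, trans i i x = 1
  trans_cocycle : ∀ i j k, ∀ x ∈ U i ∩ U j ∩ U k, trans i j x * trans j k x = trans i k x
  trans_mem_R : ∀ i j, ∀ x ∈ U i ∩ U j, trans i j x ∈ gammaR.spinGroup
  trans_mem_PR : ∀ i j, ∀ x ∈ U i ∩ U j, trans i j x ∈ gammaPR.spinGroup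
  /-- `s_{ij}` lifts the change of frame `E^j_a = ∑_b g_R(E^i_b, E^j_a) E^i_b` (Riemannian case) -/
  trans_lift_R : ∀ i j, ∀ x ∈ U i ∩ U j, ∀ a,
    trans i j x * gammaR.γ a = (∑ b, ((metric.inner x (frame i b x)
      (refl.r x (frame j a x)) : ℝ) : ℂ) • gammaR.γ b) * trans i j x
  /-- `s_{ij}` lifts the change of frame (pseudo-Riemannian case) -/
  trans_lift_PR : ∀ i j, ∀ x ∈ U i ∩ U j, ∀ a,
    trans i j x * gammaPR.γ a = (∑ b, ((metric.inner x (frame i b x)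
      (refl.r x (frame j a x)) : ℝ) : ℂ) • gammaPR.γ b) * trans i j x

section SpinManifold

variable {m n : ℕ} {M : Type*} [TopologicalSpace M] [ChartedSpace (Model m) M]
  [IsManifold (𝓡 (2 * m)) ∞ M] {ι : Type*}

namespace KreinSpinManifold

/-- The metric `g_PR`. -/
def gPR (X : KreinSpinManifold m n M ι) : TangentForm m M :=
  fun x v w => X.metric.inner x v w

/-- The Riemannian metric `g_R = g_PR(·, r ·)`. -/
def gR (X : KreinSpinManifold m n M ι) : TangentForm m M :=
  fun x v w => X.metric.inner x v (X.refl.r x w)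

/-- The common grading `Γ = Γ_R = Γ_PR`. -/
def Γ (X : KreinSpinManifold m n M ι) : SpinorMatrix m := gradingR X.gammaR

/-- A family of local expressions in the spin frames. The value of `ψ i` matters only on `U i`. -/
abbrev LocalSpinor (_X : KreinSpinManifold m n M ι) : Type _ := ι → M → SpinorSpace m

/-- `ψ` consists of the local expressions of a smooth section of the spinor bundle. -/
structure IsSmoothSpinor (X : KreinSpinManifold m n M ι) (ψ : X.LocalSpinor) : Prop where
  smooth : ∀ i, ContMDiffOn (𝓡 (2 * m)) 𝓘(ℝ, SpinorSpace m) ∞ (ψ i) (X.U i)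
  compat : ∀ i j, ∀ x ∈ X.U i ∩ X.U j, ψ i x = act (X.trans i j x) (ψ j x)

/-- The norm of `ψ` in the fibre over `x`. For a spinor all local expressions at `x` have the
same norm, because the transition functions are unitary. -/
def fibreNorm (X : KreinSpinManifold m n M ι) (ψ : X.LocalSpinor) (x : M) : ℝ≥0∞ :=
  ⨆ (i : ι) (_ : x ∈ X.U i), ‖ψ i x‖ₑ

/-- The norm of `L²(M, S)`, for the Riemannian volume. -/
def l2Norm (X : KreinSpinManifold m n M ι) [CompactSpace M] [T2Space M]
    [MeasurableSpace M] [BorelSpace M] (ψ : X.LocalSpinor) : ℝ≥0∞ :=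
  (∫⁻ x, X.fibreNorm ψ x ^ 2 ∂(riemannianVolume X.gR)) ^ (1 / 2 : ℝ)

/-- An operator with domain the smooth spinors is bounded for the norm of `L²(M, S)`. -/
def IsBoundedOp (X : KreinSpinManifold m n M ι) [CompactSpace M] [T2Space M]
    [MeasurableSpace M] [BorelSpace M] (T : X.LocalSpinor → X.LocalSpinor) : Prop :=
  ∃ C : ℝ≥0, ∀ ψ : X.LocalSpinor, X.IsSmoothSpinor ψ → X.l2Norm (T ψ) ≤ C * X.l2Norm ψ

/-- The coefficients `ω_{abc} = g(∇_{E_a} E_b, E_c)` of the Levi-Civita connection of `q` in the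
`i`-th frame, given by Koszul's formula (in which the derivatives of the constant functions
`g(E_b, E_c)` do not contribute). -/
def leviCivita (X : KreinSpinManifold m n M ι) (q : TangentForm m M) (i : ι) (x : M)
    (a b c : Fin (2 * m)) : ℝ :=
  (q x (VectorField.mlieBracket (𝓡 (2 * m)) (X.frame i a) (X.frame i b) x) (X.frame i c x)
    - q x (VectorField.mlieBracket (𝓡 (2 * m)) (X.frame i b) (X.frame i c) x) (X.frame i a x)
    + q x (VectorField.mlieBracket (𝓡 (2 * m)) (X.frame i c) (X.frame i a) x) (X.frame i b x)) / 2

/-- The derivative `E_a(ψ)` of the `i`-th local expression along the frame vector `E_a`. -/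
def frameDerivative (X : KreinSpinManifold m n M ι) (a : Fin (2 * m)) (ψ : X.LocalSpinor) (i : ι)
    (x : M) : SpinorSpace m :=
  mfderiv (𝓡 (2 * m)) 𝓘(ℝ, SpinorSpace m) (ψ i) x (X.frame i a x)

/-- The spin connection along `E_a`, in the `i`-th spin frame:
`∇_a ψ = E_a(ψ) - (1/4) ∑_{b,c} ω_{abc} γ^b γ^c ψ`. As `γ(v)² = + g(v, v)`, this is the sign for
which `[∇_a, γ(v)] = γ(∇_{E_a} v)`. -/
def spinDerivative (X : KreinSpinManifold m n M ι) (q : TangentForm m M)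
    {ε : Fin (2 * m) → ℝ} (G : GammaMatrices m ε) (a : Fin (2 * m)) (ψ : X.LocalSpinor) :
    X.LocalSpinor := fun i x =>
  X.frameDerivative a ψ i x
    + act (∑ b, ∑ c, (-(X.leviCivita q i x a b c / 4 : ℝ) : ℂ) • (G.γ b * G.γ c)) (ψ i x)

/-- The Dirac operator `-i ∑_a γ^a ∇_a`. -/
def dirac (X : KreinSpinManifold m n M ι) (q : TangentForm m M)
    {ε : Fin (2 * m) → ℝ} (G : GammaMatrices m ε) (ψ : X.LocalSpinor) : X.LocalSpinor :=
  fun i x => -Complex.I • ∑ a, act (G.γ a) (X.spinDerivative q G a ψ i x)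

/-- A constant matrix acting on spinors. -/
def matrixOp (X : KreinSpinManifold m n M ι) (A : SpinorMatrix m) (ψ : X.LocalSpinor) :
    X.LocalSpinor := fun i x => act A (ψ i x)

/-- `K₍₁₎ = i^{-n(n-1)/2} γ_R^1 ⋯ γ_R^n`. -/
def K₁ (X : KreinSpinManifold m n M ι) : SpinorMatrix m := fundSymm n X.gammaR

/-- `K₍₂₎ = i^{-n(n-1)/2} γ_PR^1 ⋯ γ_PR^n`. -/
def K₂ (X : KreinSpinManifold m n M ι) : SpinorMatrix m := fundSymm n X.gammaPR

/-- The Riemannian Dirac operator `D₍₁₎ = -i γ_R^a ∇_a^R`. -/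
def D₁ (X : KreinSpinManifold m n M ι) (ψ : X.LocalSpinor) : X.LocalSpinor :=
  X.dirac X.gR X.gammaR ψ

/-- The pseudo-Riemannian Dirac operator `D^{K₍₂₎} = -i γ_PR^a ∇_a^PR`. -/
def DK₂ (X : KreinSpinManifold m n M ι) (ψ : X.LocalSpinor) : X.LocalSpinor :=
  X.dirac X.gPR X.gammaPR ψ

/-- The dual operator `K₍₁₎ D₍₁₎`. -/
def hatDK₁ (X : KreinSpinManifold m n M ι) (ψ : X.LocalSpinor) : X.LocalSpinor :=
  X.matrixOp X.K₁ (X.D₁ ψ)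

/-- The dual operator `K₍₂₎ D^{K₍₂₎}`. -/
def hatD₂ (X : KreinSpinManifold m n M ι) (ψ : X.LocalSpinor) : X.LocalSpinor :=
  X.matrixOp X.K₂ (X.DK₂ ψ)

end KreinSpinManifold

/-! ### The doubled algebra -/

/-- The algebra `C^∞(M) ⊗ ℂ²` of pairs `a = (f, g)` of smooth complex functions. -/
abbrev DoubledAlgebra (m : ℕ) (M : Type*) [TopologicalSpace M] [ChartedSpace (Model m) M] :
    Type _ :=
  C^∞⟮𝓡 (2 * m), M; 𝓘(ℝ, ℂ), ℂ⟯ × C^∞⟮𝓡 (2 * m), M; 𝓘(ℝ, ℂ), ℂ⟯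

/-- The twist `ρ(f, g) = (g, f)`. -/
def twist (a : DoubledAlgebra m M) : DoubledAlgebra m M := (a.2, a.1)

namespace KreinSpinManifold

/-- The chiral representation `π(f, g) = p₊ f + p₋ g` with `p_± = (1 ± Γ) / 2`. -/
def rep (X : KreinSpinManifold m n M ι) (a : DoubledAlgebra m M) (ψ : X.LocalSpinor) :
    X.LocalSpinor := fun i x =>
  a.1 x • act ((1 / 2 : ℂ) • (1 + X.Γ)) (ψ i x) + a.2 x • act ((1 / 2 : ℂ) • (1 - X.Γ)) (ψ i x)

/-- The commutator `[T, a] = T a - a T`. -/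
def comm (X : KreinSpinManifold m n M ι) (T : X.LocalSpinor → X.LocalSpinor)
    (a : DoubledAlgebra m M) (ψ : X.LocalSpinor) : X.LocalSpinor :=
  T (X.rep a ψ) - X.rep a (T ψ)

/-- The twisted commutator `[T, a]_ρ = T a - ρ(a) T`. -/
def twistedComm (X : KreinSpinManifold m n M ι) (T : X.LocalSpinor → X.LocalSpinor)
    (a : DoubledAlgebra m M) (ψ : X.LocalSpinor) : X.LocalSpinor :=
  T (X.rep a ψ) - X.rep (twist a) (T ψ)

end KreinSpinManifold

end SpinManifold

end KreinDirac

end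

/-!
The statement reduces to one computation. Let `D = -i γ^a ∇_a` be either Dirac operator and
`a = (f, g)`. The gamma matrices anticommute with `Γ` (`GammaMatrices.mul_prod_ofFn`) and the
connection matrices are even, so moving `D` past `π(f, g)` exchanges `f` and `g` up to a term of
order zero (`dirac_rep`):
`D π(f, g) = π(g, f) D - i ∑_b γ^b (E_b(f) p₊ + E_b(g) p₋)`.

* The twisted commutator `[D, a]_ρ` is therefore a matrix built from the derivatives of `f` and `g`
  along orthonormal frames. These are bounded uniformly in the frame, because adapted frames differ
  by orthogonal matrices and `M` is compact (`exists_norm_mfderiv_frame_le`). This gives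
  `isBoundedOp_twistedComm_dirac`. If `f = g`, the commutator equals the twisted commutator.
* The commutator `[D, a]` is the same matrix plus `(g - f) Γ D`. On `e^{itφ} ψ` it produces the term
  `t (g - f) Γ γ(dφ) ψ` (`comm_dirac_phase`). Choose `p` with `f p ≠ g p`, a function `φ` with
  `dφ ≠ 0` at `p`, and a section `ψ` supported near `p` with `γ(dφ) ψ ≠ 0` at `p`; such a `ψ` exists
  since the gamma matrices are linearly independent. As `t` grows, the norm of `e^{itφ} ψ` stays
  below a constant, while that of its image grows linearly on a fixed neighbourhood of `p`. Since
  the Riemannian volume is finite and positive on nonempty open sets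
  (`riemannianVolume_univ_lt_top`, `riemannianVolume_pos_of_isOpen`), `[D, a]` is unbounded
  (`not_isBoundedOp_comm_dirac`). No ellipticity enters, so the pseudo-Riemannian operator is
  covered by the same argument.
* A fundamental symmetry `K` is unitary, and for odd `n` it anticommutes with `Γ`
  (`fundSymm_anticomm`). Hence `[K D, a] = K [D, a]_ρ` and `[K D, a]_ρ = K [D, a]`, and the dual
  operators behave in the opposite way.
-/

noncomputable section

namespace KreinDirac

/-! ### Clifford algebra -/

section Act

variable {m : ℕ}

lemma act_add (A : SpinorMatrix m) (v w : SpinorSpace m) : act A (v + w) = act A v + act A w :=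
  map_add _ _ _

lemma act_smul (A : SpinorMatrix m) (c : ℂ) (v : SpinorSpace m) : act A (c • v) = c • act A v :=
  map_smul _ _ _

lemma act_zero (A : SpinorMatrix m) : act A (0 : SpinorSpace m) = 0 :=
  map_zero _

lemma add_act (A B : SpinorMatrix m) (v : SpinorSpace m) : act (A + B) v = act A v + act B v := by
  simp [act]

lemma sub_act (A B : SpinorMatrix m) (v : SpinorSpace m) : act (A - B) v = act A v - act B v := by
  simp [act]

lemma smul_act (c : ℂ) (A : SpinorMatrix m) (v : SpinorSpace m) : act (c • A) v = c • act A v := by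
  simp [act]

lemma sum_act {κ : Type*} (s : Finset κ) (A : κ → SpinorMatrix m) (v : SpinorSpace m) :
    act (∑ a ∈ s, A a) v = ∑ a ∈ s, act (A a) v := by
  simp [act]

lemma mul_act (A B : SpinorMatrix m) (v : SpinorSpace m) : act (A * B) v = act A (act B v) := by
  simp [act, Matrix.toLpLin_mul_same]

lemma one_act (v : SpinorSpace m) : act (1 : SpinorMatrix m) v = v := by
  simp [act]

lemma act_sub (A : SpinorMatrix m) (v w : SpinorSpace m) : act A (v - w) = act A v - act A w :=
  map_sub _ _ _

lemma act_sum {κ : Type*} (s : Finset κ) (A : SpinorMatrix m) (v : κ → SpinorSpace m) :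
    act A (∑ a ∈ s, v a) = ∑ a ∈ s, act A (v a) :=
  map_sum _ _ _

lemma exists_act_ne_zero {A : SpinorMatrix m} (hA : A ≠ 0) : ∃ v, act A v ≠ 0 := by
  by_contra! h
  exact hA ((Matrix.toEuclideanLin (𝕜 := ℂ)).injective (by ext1 v; simpa [act] using h v))

lemma norm_act_of_mem_unitary {A : SpinorMatrix m} (hA : Aᴴ * A = 1) (v : SpinorSpace m) :
    ‖act A v‖ = ‖v‖ := by
  have h : inner ℂ (act A v) (act A v) = inner ℂ v v := by
    unfold act
    rw [← LinearMap.adjoint_inner_right, ← Matrix.toEuclideanLin_conjTranspose_eq_adjoint]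
    change inner ℂ v (act Aᴴ (act A v)) = _
    rw [← mul_act, hA, one_act]
  rw [@norm_eq_sqrt_re_inner ℂ, h, ← @norm_eq_sqrt_re_inner ℂ]

/-- A matrix acts on the finite-dimensional spinor space with a finite operator norm. -/
lemma exists_norm_act_le (A : SpinorMatrix m) : ∃ C : ℝ, 0 ≤ C ∧ ∀ v, ‖act A v‖ ≤ C * ‖v‖ :=
  ⟨‖(Matrix.toEuclideanLin A).toContinuousLinearMap‖, norm_nonneg _,
    fun v => (Matrix.toEuclideanLin A).toContinuousLinearMap.le_opNorm v⟩

/-- The map `(A, v) ↦ A v` is jointly continuous. -/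
lemma continuous_act : Continuous fun p : SpinorMatrix m × SpinorSpace m => act p.1 p.2 := by
  unfold act
  simp only [Matrix.toEuclideanLin, Matrix.toLpLin_apply]
  fun_prop

lemma continuousOn_act {Y : Type*} [TopologicalSpace Y] {A : Y → SpinorMatrix m}
    {v : Y → SpinorSpace m} {s : Set Y} (hA : ContinuousOn A s) (hv : ContinuousOn v s) :
    ContinuousOn (fun x => act (A x) (v x)) s := by
  have h : ContinuousOn (fun x => (A x, v x)) s := hA.prodMk hv
  have h' : Continuous fun p : SpinorMatrix m × SpinorSpace m => act p.1 p.2 := continuous_act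
  generalize hf : (fun p : SpinorMatrix m × SpinorSpace m => act p.1 p.2) = f at h'
  have e : (fun x => act (A x) (v x)) = fun x => f (A x, v x) := by subst hf; rfl
  rw [e]
  exact h'.comp_continuousOn h

end Act

/-- Elements anticommuting with `x` anticommute with it up to a sign given by their number. -/
lemma mul_list_prod_of_anticomm {R : Type*} [Ring R] (x : R) :
    ∀ l : List R, (∀ y ∈ l, x * y = -(y * x)) → x * l.prod = (-1) ^ l.length * (l.prod * x)
  | [], _ => by simp
  | y :: l, h => by
    have ih := mul_list_prod_of_anticomm x l fun z hz => h z (List.mem_cons_of_mem _ hz)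
    have hy := h y List.mem_cons_self
    have hc : Commute y ((-1 : R) ^ l.length) := (Commute.neg_one_right y).pow_right _
    rw [List.prod_cons, ← mul_assoc, hy, neg_mul, mul_assoc, ih, List.length_cons, pow_succ,
      ← mul_assoc y, hc.eq]
    simp [mul_assoc]

namespace GammaMatrices

variable {m : ℕ} {ε : Fin (2 * m) → ℝ} (G : GammaMatrices m ε)

lemma anticomm {a b : Fin (2 * m)} (h : a ≠ b) : G.γ a * G.γ b = -(G.γ b * G.γ a) := by
  have := G.clifford a b
  rw [if_neg h] at this
  exact eq_neg_of_add_eq_zero_left this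

lemma conjTranspose_mul_self (a : Fin (2 * m)) : (G.γ a)ᴴ * G.γ a = 1 :=
  Matrix.mem_unitaryGroup_iff'.mp (G.unitary a)

/-- Moving `γ^b` past a product of gamma matrices gives one sign for each factor other than
`γ^b`. -/
lemma mul_prod_map (b : Fin (2 * m)) : ∀ l : List (Fin (2 * m)),
    G.γ b * (l.map G.γ).prod = (-1) ^ (l.countP (· ≠ b)) * ((l.map G.γ).prod * G.γ b)
  | [] => by simp
  | a :: l => by
    have ih := mul_prod_map b l
    have hc : Commute (G.γ a) ((-1 : SpinorMatrix m) ^ l.countP (· ≠ b)) :=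
      (Commute.neg_one_right _).pow_right _
    by_cases h : a = b
    · subst h
      rw [List.map_cons, List.prod_cons, List.countP_cons_of_neg (by simp),
        mul_assoc (G.γ a) _ (G.γ a),
        ← mul_assoc ((-1) ^ _) (G.γ a), ← hc.eq, mul_assoc, ih]
    · rw [List.map_cons, List.prod_cons, ← mul_assoc, G.anticomm (Ne.symm h), neg_mul, mul_assoc,
        ih, List.countP_cons_of_pos (by simpa using h), pow_succ, ← mul_assoc (G.γ a), hc.eq]
      simp [mul_assoc]

/-- The product of all `2m` gamma matrices anticommutes with each of them, because `2m - 1` is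
odd. -/
lemma mul_prod_ofFn (b : Fin (2 * m)) :
    G.γ b * (List.ofFn G.γ).prod = -((List.ofFn G.γ).prod * G.γ b) := by
  have hm : 0 < 2 * m := b.pos
  have hc : (List.finRange (2 * m)).countP (· ≠ b) = 2 * m - 1 := by
    have h1 := List.length_eq_countP_add_countP (fun a => decide (a = b))
      (l := List.finRange (2 * m))
    have h2 : (List.finRange (2 * m)).countP (fun a => decide (a = b)) = 1 := by
      have := List.count_eq_one_of_mem (List.nodup_finRange (2 * m)) (List.mem_finRange b)
      rw [List.count] at this
      rw [← this]
      congr 1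
    rw [h2, List.length_finRange] at h1
    have h3 : (List.finRange (2 * m)).countP (· ≠ b)
        = (List.finRange (2 * m)).countP (fun a => decide ¬ decide (a = b) = true) := by
      congr 1; ext a; simp
    omega
  have hodd : Odd (2 * m - 1) := by
    refine ⟨m - 1, by omega⟩
  rw [List.ofFn_eq_map, G.mul_prod_map b, hc, hodd.neg_one_pow, neg_one_mul]

lemma slash_mul_add (u : Fin (2 * m) → ℝ) (b : Fin (2 * m)) :
    G.slash u * G.γ b + G.γ b * G.slash u = ((2 * (ε b * u b) : ℝ) : ℂ) • (1 : SpinorMatrix m) := by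
  simp only [slash, Finset.sum_mul, Finset.mul_sum, ← Finset.sum_add_distrib, smul_mul_assoc,
    mul_smul_comm, ← smul_add, G.clifford]
  rw [Finset.sum_eq_single b (fun a _ h => by simp [h]) (by simp)]
  simp only [if_true, smul_smul]
  congr 1
  push_cast
  ring

lemma slash_mul_slash (u : Fin (2 * m) → ℝ) :
    G.slash u * G.slash u = ((∑ a, ε a * u a ^ 2 : ℝ) : ℂ) • (1 : SpinorMatrix m) := by
  have h : (2 : ℂ) • (G.slash u * G.slash u)
      = (2 : ℂ) • (((∑ a, ε a * u a ^ 2 : ℝ) : ℂ) • (1 : SpinorMatrix m)) := by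
    have e : (2 : ℂ) • (G.slash u * G.slash u)
        = ∑ b, (u b : ℂ) • (G.slash u * G.γ b + G.γ b * G.slash u) := by
      simp only [smul_add, Finset.sum_add_distrib, ← mul_smul_comm, ← Finset.mul_sum]
      simp only [mul_smul_comm, ← smul_mul_assoc, ← Finset.sum_mul]
      change ((2 : ℂ) • G.slash u) * G.slash u = G.slash u * G.slash u + G.slash u * G.slash u
      rw [two_smul, add_mul]
    -- Summed against `u`, the anticommutator with `γ^b` gives twice the square.
    rw [e]
    simp only [slash_mul_add, smul_smul, ← Finset.sum_smul]
    congr 1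
    push_cast
    rw [Finset.mul_sum]
    exact Finset.sum_congr rfl fun a _ => by ring
  exact smul_right_injective (SpinorMatrix m) (two_ne_zero (α := ℂ)) h

/-- The gamma matrices are linearly independent. -/
lemma slash_ne_zero (hε : ∀ a, ε a ≠ 0) {u : Fin (2 * m) → ℝ} {b : Fin (2 * m)} (hb : u b ≠ 0) :
    G.slash u ≠ 0 := by
  intro h
  have h1 := G.slash_mul_add u b
  rw [h, zero_mul, mul_zero, add_zero, eq_comm, smul_eq_zero] at h1
  rcases h1 with h1 | h1
  · have : (2 * (ε b * u b) : ℝ) = 0 := by exact_mod_cast h1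
    simp [hε b, hb] at this
  · exact one_ne_zero h1

end GammaMatrices

section Spin

variable {m : ℕ} (G : GammaMatrices m (signR m))

lemma GammaMatrices.isHermitian (a : Fin (2 * m)) : (G.γ a)ᴴ = G.γ a := by
  have h1 : G.γ a * G.γ a = 1 := by
    have h := G.clifford a a
    rw [if_pos rfl, ← two_smul ℂ] at h
    refine smul_right_injective (SpinorMatrix m) (two_ne_zero (α := ℂ)) (h.trans ?_)
    simp [signR]
  calc (G.γ a)ᴴ = (G.γ a)ᴴ * (G.γ a * G.γ a) := by rw [h1, mul_one]
    _ = G.γ a := by rw [← mul_assoc, G.conjTranspose_mul_self, one_mul]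

/-- The compact spin group acts by unitary matrices. -/
lemma conjTranspose_mul_self_of_mem_spinGroup {A : SpinorMatrix m} (hA : A ∈ G.spinGroup) :
    Aᴴ * A = 1 := by
  have key : ∀ u : Fin (2 * m) → ℝ, |∑ a, signR m a * u a ^ 2| = 1 →
      (G.slash u)ᴴ * G.slash u = 1 := by
    intro u hu
    have h1 : (G.slash u)ᴴ = G.slash u := by
      simp [GammaMatrices.slash, Matrix.conjTranspose_sum, G.isHermitian]
    have h2 : 0 ≤ ∑ a, signR m a * u a ^ 2 :=
      Finset.sum_nonneg fun a _ => by simp [signR, sq_nonneg]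
    rw [abs_of_nonneg h2] at hu
    rw [h1, G.slash_mul_slash, hu]
    simp
  induction hA using Submonoid.closure_induction with
  | mem x hx =>
    obtain ⟨u, v, hu, hv, rfl⟩ := hx
    rw [Matrix.conjTranspose_mul, mul_assoc, ← mul_assoc _ (G.slash u), key u hu, one_mul, key v hv]
  | one => simp
  | mul x y _ _ hx hy =>
    rw [Matrix.conjTranspose_mul, mul_assoc, ← mul_assoc _ x, hx, one_mul, hy]

end Spin

section Chiral

variable {m : ℕ}

/-- The matrix `z p₊ + w p₋`, where `p_± = (1 ± Γ) / 2`. -/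
def chiral (Γ : SpinorMatrix m) (z w : ℂ) : SpinorMatrix m :=
  z • ((1 / 2 : ℂ) • (1 + Γ)) + w • ((1 / 2 : ℂ) • (1 - Γ))

lemma chiral_act (Γ : SpinorMatrix m) (z w : ℂ) (v : SpinorSpace m) :
    act (chiral Γ z w) v
      = z • act ((1 / 2 : ℂ) • (1 + Γ)) v + w • act ((1 / 2 : ℂ) • (1 - Γ)) v := by
  rw [chiral, add_act, smul_act z, smul_act w]

lemma chiral_self (Γ : SpinorMatrix m) (z : ℂ) : chiral Γ z z = z • 1 := by
  unfold chiral
  module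

lemma chiral_sub_swap (Γ : SpinorMatrix m) (z w : ℂ) :
    chiral Γ w z - chiral Γ z w = (w - z) • Γ := by
  unfold chiral
  module

/-- A matrix anticommuting with the grading exchanges the two chiralities. -/
lemma mul_chiral_of_anticomm {Γ A : SpinorMatrix m} (h : A * Γ = -(Γ * A)) (z w : ℂ) :
    A * chiral Γ z w = chiral Γ w z * A := by
  simp only [chiral, mul_add, add_mul, mul_sub, sub_mul, mul_smul_comm, smul_mul_assoc, h]
  simp only [mul_one, one_mul]
  module

lemma mul_chiral_of_comm {Γ A : SpinorMatrix m} (h : A * Γ = Γ * A) (z w : ℂ) :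
    A * chiral Γ z w = chiral Γ z w * A := by
  simp only [chiral, mul_add, add_mul, mul_sub, sub_mul, mul_smul_comm, smul_mul_assoc, h, mul_one,
    one_mul]

end Chiral

section FundSymm

variable {m : ℕ} {ε : Fin (2 * m) → ℝ} (G : GammaMatrices m ε)

lemma conjTranspose_mul_self_of_smul_prod (l : List (SpinorMatrix m))
    (hl : ∀ A ∈ l, A ∈ List.ofFn G.γ) (k : ℤ) :
    (Complex.I ^ k • l.prod)ᴴ * (Complex.I ^ k • l.prod) = 1 := by
  have h : l.prod ∈ Matrix.unitaryGroup (Fin (2 ^ m)) ℂ := by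
    refine list_prod_mem fun A hA => ?_
    obtain ⟨a, rfl⟩ := (List.mem_ofFn' _ _).mp (hl A hA)
    exact G.unitary a
  have h' : l.prodᴴ * l.prod = 1 := Matrix.mem_unitaryGroup_iff'.mp h
  rw [Matrix.conjTranspose_smul, smul_mul_smul_comm, h']
  have : star (Complex.I ^ k) * Complex.I ^ k = 1 := by
    rw [Complex.star_def, Complex.conj_mul']
    simp
  rw [this, one_smul]

lemma fundSymm_conjTranspose_mul_self (n : ℕ) : (fundSymm n G)ᴴ * fundSymm n G = 1 :=
  conjTranspose_mul_self_of_smul_prod G _ (fun _ hA => List.mem_of_mem_take hA) _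

/-- For odd `n` the fundamental symmetry is odd. -/
lemma fundSymm_anticomm {n : ℕ} (hn : Odd n) (hnm : n < 2 * m) {Γ : SpinorMatrix m}
    (hΓ : ∀ a, G.γ a * Γ = -(Γ * G.γ a)) : fundSymm n G * Γ = -(Γ * fundSymm n G) := by
  have h := mul_list_prod_of_anticomm Γ ((List.ofFn G.γ).take n) fun y hy => by
    obtain ⟨a, rfl⟩ := (List.mem_ofFn' _ _).mp (List.mem_of_mem_take hy)
    rw [hΓ a, neg_neg]
  have hlen : ((List.ofFn G.γ).take n).length = n := by simp; omega
  rw [hlen, hn.neg_one_pow, neg_one_mul] at h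
  simp only [fundSymm, smul_mul_assoc, mul_smul_comm, h]
  simp

lemma gradingR_conjTranspose_mul_self (G : GammaMatrices m (signR m)) :
    (gradingR G)ᴴ * gradingR G = 1 :=
  conjTranspose_mul_self_of_smul_prod G _ (fun _ hA => hA) m

lemma gradingR_anticomm (G : GammaMatrices m (signR m)) (a : Fin (2 * m)) :
    G.γ a * gradingR G = -(gradingR G * G.γ a) := by
  simp [gradingR, G.mul_prod_ofFn a]

lemma gradingPR_anticomm {n : ℕ} (G : GammaMatrices m (signPR m n)) (a : Fin (2 * m)) :
    G.γ a * gradingPR G = -(gradingPR G * G.γ a) := by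
  simp [gradingPR, G.mul_prod_ofFn a]

/-- Elements of the spin group are even. -/
lemma mul_gradingR_of_mem_spinGroup (G : GammaMatrices m (signR m)) {A : SpinorMatrix m}
    (hA : A ∈ G.spinGroup) : A * gradingR G = gradingR G * A := by
  have hs : ∀ u, G.slash u * gradingR G = -(gradingR G * G.slash u) := fun u => by
    simp only [GammaMatrices.slash, Finset.sum_mul, Finset.mul_sum, smul_mul_assoc, mul_smul_comm,
      gradingR_anticomm, smul_neg, Finset.sum_neg_distrib]
  induction hA using Submonoid.closure_induction with
  | mem x hx =>
    obtain ⟨u, v, -, -, rfl⟩ := hx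
    rw [mul_assoc, hs, mul_neg, ← mul_assoc, hs, neg_mul, neg_neg, mul_assoc]
  | one => simp
  | mul x y _ _ hx hy => rw [mul_assoc, hy, ← mul_assoc, hx, mul_assoc]

end FundSymm

/-! ### Continuity of metric expressions -/

section Geometry

variable {m : ℕ} {M : Type*} [TopologicalSpace M] [ChartedSpace (Model m) M]
  [IsManifold (𝓡 (2 * m)) ∞ M]

/-- The derivative of a smooth function along a continuous vector field is continuous. -/
lemma continuousOn_mfderiv_apply {F : Type*} [NormedAddCommGroup F] [NormedSpace ℝ F]
    {f : M → F} {U : Set M} (hU : IsOpen U) (hf : ContMDiffOn (𝓡 (2 * m)) 𝓘(ℝ, F) ∞ f U)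
    {V : (x : M) → TangentSpace (𝓡 (2 * m)) x}
    (hV : ContinuousOn (fun x => (⟨x, V x⟩ : TangentBundle (𝓡 (2 * m)) M)) U) :
    ContinuousOn (fun x => (mfderiv (𝓡 (2 * m)) 𝓘(ℝ, F) f x (V x) : F)) U := by
  have h1 := hf.continuousOn_tangentMapWithin (by simp) hU.uniqueMDiffOn
  have h2 := h1.comp hV (fun x hx => hx)
  have h3 := (contMDiff_snd_tangentBundle_modelSpace F 𝓘(ℝ, F) (n := 0)).continuous.comp_continuousOn
    h2
  refine h3.congr fun x hx => ?_
  simp only [Function.comp, tangentMapWithin, mfderivWithin_of_isOpen hU hx]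
  rfl

lemma PseudoRiemannianMetric.continuousOn_inner (g : PseudoRiemannianMetric m M)
    {N : Type*} [TopologicalSpace N] {b : N → M} {s : Set N}
    {V W : (y : N) → TangentSpace (𝓡 (2 * m)) (b y)}
    (hV : ContinuousOn (fun y => (⟨b y, V y⟩ : TangentBundle (𝓡 (2 * m)) M)) s)
    (hW : ContinuousOn (fun y => (⟨b y, W y⟩ : TangentBundle (𝓡 (2 * m)) M)) s) :
    ContinuousOn (fun y => g.inner (b y) (V y) (W y)) s := by
  have hb : ContinuousOn b s :=
    (FiberBundle.continuous_proj (Model m) (TangentSpace (𝓡 (2 * m)) (M := M))).comp_continuousOn hV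
  have hg := g.contMDiff.continuous.comp_continuousOn hb
  have h : ContinuousOn (fun y => Bundle.TotalSpace.mk' ℝ (E := Bundle.Trivial M ℝ) (b y)
      (g.inner (b y) (V y) (W y))) s :=
    ContinuousOn.clm_bundle_apply₂ (F₁ := Model m) (F₂ := Model m)
      (E₁ := TangentSpace (𝓡 (2 * m)) (M := M)) (E₂ := TangentSpace (𝓡 (2 * m)) (M := M))
      (E₃ := Bundle.Trivial M ℝ) (ψ := fun y => g.inner (b y)) hg hV hW
  exact ((Bundle.Trivial.homeomorphProd M ℝ).continuous.comp_continuousOn h).snd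

lemma SpacelikeReflection.continuousOn_apply {g : PseudoRiemannianMetric m M}
    (r : SpacelikeReflection g) {N : Type*} [TopologicalSpace N] {b : N → M} {s : Set N}
    {V : (y : N) → TangentSpace (𝓡 (2 * m)) (b y)}
    (hV : ContinuousOn (fun y => (⟨b y, V y⟩ : TangentBundle (𝓡 (2 * m)) M)) s) :
    ContinuousOn (fun y => (⟨b y, r.r (b y) (V y)⟩ : TangentBundle (𝓡 (2 * m)) M)) s := by
  have hb : ContinuousOn b s :=
    (FiberBundle.continuous_proj (Model m) (TangentSpace (𝓡 (2 * m)) (M := M))).comp_continuousOn hV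
  exact ContinuousOn.clm_bundle_apply (F₁ := Model m) (F₂ := Model m)
      (E₁ := TangentSpace (𝓡 (2 * m)) (M := M)) (E₂ := TangentSpace (𝓡 (2 * m)) (M := M))
      (ϕ := fun y => r.r (b y)) (r.contMDiff.continuous.comp_continuousOn hb) hV

lemma continuousOn_coordVector (x₀ : M) (k : Fin (2 * m)) :
    ContinuousOn (fun y => (⟨(chartAt (Model m) x₀).symm y, coordVector x₀ k y⟩ :
      TangentBundle (𝓡 (2 * m)) M)) (chartAt (Model m) x₀).target := by
  have h1 := (contMDiffOn_chart_symm (I := 𝓡 (2 * m)) (n := ∞) (x := x₀)).continuousOn_tangentMapWithin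
    (by simp) (chartAt (Model m) x₀).open_target.uniqueMDiffOn
  have h2 : Continuous fun y : Model m =>
      (⟨y, (EuclideanSpace.single k (1 : ℝ) : Model m)⟩ : TangentBundle 𝓘(ℝ, Model m) (Model m)) :=
    (tangentBundleModelSpaceHomeomorph 𝓘(ℝ, Model m)).symm.continuous.comp
      (continuous_id.prodMk continuous_const)
  refine (h1.comp h2.continuousOn fun y hy => hy).congr fun y hy => ?_
  simp only [Function.comp, tangentMapWithin,
    mfderivWithin_of_isOpen (chartAt (Model m) x₀).open_target hy]
  rfl

/-- The coordinate vector fields of a chart are linearly independent. -/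
lemma sum_smul_coordVector_ne_zero (x₀ : M) {y : Model m} (hy : y ∈ (chartAt (Model m) x₀).target)
    {c : Fin (2 * m) → ℝ} (hc : c ≠ 0) : ∑ k, c k • coordVector x₀ k y ≠ 0 := by
  set e := chartAt (Model m) x₀
  set L := mfderiv 𝓘(ℝ, Model m) (𝓡 (2 * m)) e.symm y
  have hsum : ∑ k, c k • coordVector x₀ k y = L (WithLp.toLp 2 c : Model m) := by
    have : (WithLp.toLp 2 c : Model m) = ∑ k, c k • (EuclideanSpace.single k (1 : ℝ) : Model m) := by
      ext j
      simp [Pi.single_apply]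
    rw [this]
    exact (map_sum L _ _).symm ▸ Finset.sum_congr rfl fun k _ => (map_smul L _ _).symm
  rw [hsum]
  intro h0
  have h1 : MDifferentiableAt (𝓡 (2 * m)) 𝓘(ℝ, Model m) e (e.symm y) :=
    mdifferentiableAt_atlas (ChartedSpace.chart_mem_atlas x₀) (e.map_target hy)
  have h2 : MDifferentiableAt 𝓘(ℝ, Model m) (𝓡 (2 * m)) e.symm y :=
    mdifferentiableAt_atlas_symm (ChartedSpace.chart_mem_atlas x₀) hy
  have h3 : mfderiv 𝓘(ℝ, Model m) 𝓘(ℝ, Model m) (e ∘ e.symm) y (WithLp.toLp 2 c : Model m) = 0 := by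
    rw [mfderiv_comp y h1 h2]
    change mfderiv _ _ e (e.symm y) (L _) = 0
    rw [h0, map_zero]
  have h4 : (e ∘ e.symm) =ᶠ[nhds y] id := by
    filter_upwards [e.open_target.mem_nhds hy] with z hz using e.right_inv hz
  rw [h4.mfderiv_eq, mfderiv_id] at h3
  apply hc
  have h5 : (WithLp.toLp 2 c : Model m) = 0 := h3
  funext k
  simpa using congrArg (fun v : Model m => v k) h5

end Geometry

/-! ### Adapted frames -/

namespace KreinSpinManifold

section Frames

variable {m n : ℕ} {M : Type*} [TopologicalSpace M] [ChartedSpace (Model m) M]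
  [IsManifold (𝓡 (2 * m)) ∞ M] {ι : Type*} (X : KreinSpinManifold m n M ι)

lemma gR_symm (x : M) (v w : TangentSpace (𝓡 (2 * m)) x) : X.gR x v w = X.gR x w v := by
  have h := X.refl.isometric x v (X.refl.r x w)
  rw [X.refl.involutive] at h
  simp only [gR]
  rw [← h, X.metric.symm]

lemma gR_pos (x : M) {v : TangentSpace (𝓡 (2 * m)) x} (hv : v ≠ 0) : 0 < X.gR x v v :=
  X.refl.pos x v hv

lemma gR_sum_smul (x : M) {κ : Type*} [Fintype κ] (c d : κ → ℝ)
    (v : κ → TangentSpace (𝓡 (2 * m)) x) :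
    X.gR x (∑ k, c k • v k) (∑ k, d k • v k) = ∑ k, ∑ l, c k * d l * X.gR x (v k) (v l) := by
  simp only [gR, map_sum, map_smul, sum_apply, smul_apply,
    smul_eq_mul, Finset.mul_sum, mul_assoc]
  rw [Finset.sum_comm]
  exact Finset.sum_congr rfl fun k _ => Finset.sum_congr rfl fun l _ => by ring

lemma continuousOn_gPR {N : Type*} [TopologicalSpace N] {b : N → M} {s : Set N}
    {V W : (y : N) → TangentSpace (𝓡 (2 * m)) (b y)}
    (hV : ContinuousOn (fun y => (⟨b y, V y⟩ : TangentBundle (𝓡 (2 * m)) M)) s)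
    (hW : ContinuousOn (fun y => (⟨b y, W y⟩ : TangentBundle (𝓡 (2 * m)) M)) s) :
    ContinuousOn (fun y => X.gPR (b y) (V y) (W y)) s :=
  X.metric.continuousOn_inner hV hW

lemma continuousOn_gR {N : Type*} [TopologicalSpace N] {b : N → M} {s : Set N}
    {V W : (y : N) → TangentSpace (𝓡 (2 * m)) (b y)}
    (hV : ContinuousOn (fun y => (⟨b y, V y⟩ : TangentBundle (𝓡 (2 * m)) M)) s)
    (hW : ContinuousOn (fun y => (⟨b y, W y⟩ : TangentBundle (𝓡 (2 * m)) M)) s) :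
    ContinuousOn (fun y => X.gR (b y) (V y) (W y)) s :=
  X.metric.continuousOn_inner hV (X.refl.continuousOn_apply hW)

lemma gR_frame {i : ι} {x : M} (hx : x ∈ X.U i) (a b : Fin (2 * m)) :
    X.gR x (X.frame i a x) (X.frame i b x) = if a = b then 1 else 0 := by
  simp only [gR, X.frame_adapted i x hx, map_smul, X.frame_orthonormal i x hx, smul_eq_mul]
  by_cases h : a = b
  · subst h
    simp only [if_true, signPR]
    split_ifs <;> norm_num
  · simp [h]

lemma linearIndependent_frame {i : ι} {x : M} (hx : x ∈ X.U i) :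
    LinearIndependent ℝ (fun a => X.frame i a x) := by
  rw [Fintype.linearIndependent_iff]
  intro c hc b
  have h : X.gR x (∑ a, c a • X.frame i a x) (∑ a, (Pi.single b 1 : Fin (2 * m) → ℝ) a •
      X.frame i a x) = 0 := by
    rw [hc]; simp [gR]
  rw [gR_sum_smul] at h
  simpa [X.gR_frame hx, Pi.single_apply] using h

lemma frame_ne_zero {i : ι} {x : M} (hx : x ∈ X.U i) (a : Fin (2 * m)) : X.frame i a x ≠ 0 :=
  (X.linearIndependent_frame hx).ne_zero a

/-- Two adapted frames at a point differ by an orthogonal matrix, whose coefficients are bounded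
by `1`. -/
lemma exists_frame_change {i j : ι} {x : M} (hi : x ∈ X.U i) (hj : x ∈ X.U j) (a : Fin (2 * m)) :
    ∃ c : Fin (2 * m) → ℝ, (∀ b, |c b| ≤ 1) ∧ ∑ b, c b • X.frame i b x = X.frame j a x := by
  have hcard : Fintype.card (Fin (2 * m)) = Module.finrank ℝ (TangentSpace (𝓡 (2 * m)) x) := by
    change _ = Module.finrank ℝ (Model m)
    simp
  have : FiniteDimensional ℝ (TangentSpace (𝓡 (2 * m)) x) :=
    inferInstanceAs (FiniteDimensional ℝ (Model m))
  have hspan := (X.linearIndependent_frame hi).span_eq_top_of_card_eq_finrank' hcard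
  have hmem : X.frame j a x ∈ Submodule.span ℝ (Set.range fun b => X.frame i b x) := by
    rw [hspan]; trivial
  obtain ⟨c, hc⟩ := (Submodule.mem_span_range_iff_exists_fun ℝ).mp hmem
  refine ⟨c, fun b => ?_, hc⟩
  have h1 : X.gR x (X.frame j a x) (X.frame j a x) = 1 := by simp [X.gR_frame hj]
  rw [← hc, gR_sum_smul] at h1
  simp only [X.gR_frame hi, mul_ite, mul_one, mul_zero, Finset.sum_ite_eq, Finset.mem_univ,
    if_true] at h1
  have h2 : c b * c b ≤ ∑ k, c k * c k :=
    Finset.single_le_sum (f := fun k => c k * c k) (fun k _ => mul_self_nonneg _)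
      (Finset.mem_univ b)
  rw [h1] at h2
  exact abs_le.mpr (abs_le.mp ((sq_le_one_iff_abs_le_one _).mp (by rw [sq]; exact h2)))

lemma continuousOn_frame (i : ι) (a : Fin (2 * m)) :
    ContinuousOn (fun x => (⟨x, X.frame i a x⟩ : TangentBundle (𝓡 (2 * m)) M)) (X.U i) :=
  (X.frame_smooth i a).continuousOn

/-- The derivative `E_a(f)` of a function along a frame vector. -/
def frameDeriv {F : Type*} [NormedAddCommGroup F] [NormedSpace ℝ F] (f : M → F) (i : ι)
    (a : Fin (2 * m)) (x : M) : F :=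
  mfderiv (𝓡 (2 * m)) 𝓘(ℝ, F) f x (X.frame i a x)

/-- On a compact manifold the derivatives of a smooth function along all adapted frame vectors are
uniformly bounded, although there may be infinitely many frames. -/
lemma exists_norm_mfderiv_frame_le [CompactSpace M] {F : Type*} [NormedAddCommGroup F]
    [NormedSpace ℝ F] {f : M → F} (hf : ContMDiff (𝓡 (2 * m)) 𝓘(ℝ, F) ∞ f) :
    ∃ C : ℝ, 0 ≤ C ∧ ∀ i, ∀ x ∈ X.U i, ∀ a,
      ‖X.frameDeriv f i a x‖ ≤ C := by
  suffices h : ∃ C : ℝ, 0 ≤ C ∧ ∀ x ∈ (Set.univ : Set M), ∀ i, x ∈ X.U i → ∀ a,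
      ‖X.frameDeriv f i a x‖ ≤ C by
    obtain ⟨C, h0, hC⟩ := h
    exact ⟨C, h0, fun i x hx a => hC x trivial i hx a⟩
  refine isCompact_univ.induction_on ⟨0, le_rfl, by simp⟩ ?_ ?_ ?_
  · rintro s t hst ⟨C, h0, hC⟩
    exact ⟨C, h0, fun x hx => hC x (hst hx)⟩
  · rintro s t ⟨C, h0, hC⟩ ⟨C', h0', hC'⟩
    refine ⟨max C C', le_max_of_le_left h0, ?_⟩
    rintro x (hx | hx) i hi a
    · exact (hC x hx i hi a).trans (le_max_left _ _)
    · exact (hC' x hx i hi a).trans (le_max_right _ _)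
  · -- Near `p` the derivatives along a fixed frame are bounded, hence those along all frames.
    intro p _
    obtain ⟨i₀, hp⟩ := X.cover p
    set S : M → ℝ := fun x => ∑ b, ‖X.frameDeriv f i₀ b x‖
    have hS : ContinuousOn S (X.U i₀) := continuousOn_finsetSum _ fun b _ =>
      (continuousOn_mfderiv_apply (X.isOpen_U i₀) hf.contMDiffOn (X.continuousOn_frame i₀ b)).norm
    have hS0 : 0 ≤ S p := Finset.sum_nonneg fun b _ => norm_nonneg _
    have hnhds : ∀ᶠ x in nhds p, x ∈ X.U i₀ ∧ S x < S p + 1 :=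
      Filter.Eventually.and ((X.isOpen_U i₀).mem_nhds hp) <|
        ((hS.continuousAt ((X.isOpen_U i₀).mem_nhds hp)).eventually
          (gt_mem_nhds (lt_add_one (S p))))
    refine ⟨_, mem_nhdsWithin_of_mem_nhds hnhds, S p + 1, by linarith, ?_⟩
    rintro x ⟨hx, hSx⟩ i hi a
    obtain ⟨c, hc1, hc⟩ := X.exists_frame_change hx hi a
    refine le_trans ?_ hSx.le
    have hexp : X.frameDeriv f i a x = ∑ b, c b • X.frameDeriv f i₀ b x := by
      unfold frameDeriv
      rw [← hc, map_sum]
      exact Finset.sum_congr rfl fun b _ => map_smul _ _ _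
    rw [hexp]
    refine (norm_sum_le _ _).trans (Finset.sum_le_sum fun b _ => (norm_smul_le _ _).trans ?_)
    exact mul_le_of_le_one_left (norm_nonneg _) (by simpa using hc1 b)

end Frames

end KreinSpinManifold

/-! ### The Riemannian volume -/

section ChartVolume

variable {m : ℕ} {M : Type*} [TopologicalSpace M] [ChartedSpace (Model m) M]
  [MeasurableSpace M] [BorelSpace M]

/-- The image in `M` of the measure with density `√(det g_{kl})` in the chart at `x₀`. -/
def chartVolume (q : TangentForm m M) (x₀ : M) : Measure M :=
  ((volume.restrict (chartAt (Model m) x₀).target).withDensity (volumeDensity q x₀)).map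
    (chartAt (Model m) x₀).symm

/-- The inverse chart is measurable only on the target; the measure vanishes elsewhere, which keeps
`Measure.map` from being the junk value `0`. -/
lemma aemeasurable_chart_symm (q : TangentForm m M) (x₀ : M) :
    AEMeasurable (chartAt (Model m) x₀).symm
      ((volume.restrict (chartAt (Model m) x₀).target).withDensity (volumeDensity q x₀)) :=
  ((chartAt (Model m) x₀).continuousOn_symm.aemeasurable
    (chartAt (Model m) x₀).open_target.measurableSet).mono_ac (withDensity_absolutelyContinuous _ _)

end ChartVolume

section Volume

variable {m n : ℕ} {M : Type*} [TopologicalSpace M] [ChartedSpace (Model m) M]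
  [IsManifold (𝓡 (2 * m)) ∞ M] {ι : Type*} (X : KreinSpinManifold m n M ι)

lemma continuousOn_volumeDensity (x₀ : M) :
    ContinuousOn (volumeDensity X.gR x₀) (chartAt (Model m) x₀).target := by
  refine ENNReal.continuous_ofReal.comp_continuousOn
    (Real.continuous_sqrt.comp_continuousOn ?_)
  refine (Continuous.matrix_det continuous_id).comp_continuousOn ?_
  exact continuousOn_pi.mpr fun k => continuousOn_pi.mpr fun l =>
    X.continuousOn_gR (continuousOn_coordVector x₀ k) (continuousOn_coordVector x₀ l)

lemma volumeDensity_pos (x₀ : M) {y : Model m} (hy : y ∈ (chartAt (Model m) x₀).target) :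
    0 < volumeDensity X.gR x₀ y := by
  refine ENNReal.ofReal_pos.mpr (Real.sqrt_pos.mpr (Matrix.PosDef.det_pos ?_))
  refine Matrix.PosDef.of_dotProduct_mulVec_pos ?_ fun c hc => ?_
  · ext k l
    exact X.gR_symm _ _ _
  · have h := X.gR_pos _ (sum_smul_coordVector_ne_zero x₀ hy hc)
    rw [X.gR_sum_smul] at h
    refine h.trans_eq ?_
    simp only [dotProduct, Matrix.mulVec, Finset.mul_sum, Matrix.of_apply, star_trivial]
    exact Finset.sum_congr rfl fun k _ => Finset.sum_congr rfl fun l _ => by ring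

variable [MeasurableSpace M] [BorelSpace M]

lemma chartVolume_pos_of_isOpen (x₀ : M) {W : Set M} (hW : IsOpen W) {p : M} (hp : p ∈ W)
    (hps : p ∈ (chartAt (Model m) x₀).source) : 0 < chartVolume X.gR x₀ W := by
  set e := chartAt (Model m) x₀
  set ν := (volume.restrict e.target).withDensity (volumeDensity X.gR x₀)
  have hep : e p ∈ e.target := e.map_source hps
  obtain ⟨c, hc0, hc⟩ := exists_between (volumeDensity_pos X x₀ hep)
  set O := (e.target ∩ e.symm ⁻¹' W) ∩ volumeDensity X.gR x₀ ⁻¹' Set.Ioi c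
  have hO : IsOpen O :=
    ((continuousOn_volumeDensity X x₀).mono Set.inter_subset_left).isOpen_inter_preimage
      (e.symm.isOpen_inter_preimage hW) isOpen_Ioi
  have hpO : e p ∈ O := ⟨⟨hep, by simpa [e.left_inv hps] using hp⟩, hc⟩
  have hOt : O ⊆ e.target := fun y hy => hy.1.1
  rw [chartVolume, Measure.map_apply_of_aemeasurable (aemeasurable_chart_symm _ x₀)
    hW.measurableSet]
  refine lt_of_lt_of_le ?_ (measure_mono (fun y hy => hy.1.2 : O ⊆ e.symm ⁻¹' W))
  rw [withDensity_apply _ hO.measurableSet]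
  refine lt_of_lt_of_le ?_ (setLIntegral_mono' (f := fun _ => c) hO.measurableSet
    fun y hy => (le_of_lt hy.2 : c ≤ volumeDensity X.gR x₀ y))
  rw [setLIntegral_const, Measure.restrict_apply hO.measurableSet, Set.inter_eq_left.mpr hOt]
  exact ENNReal.mul_pos hc0.ne' (hO.measure_pos _ ⟨_, hpO⟩).ne'

variable [T2Space M]

lemma chartVolume_lt_top_of_isCompact (x₀ : M) {K : Set M} (hK : IsCompact K)
    (hKs : K ⊆ (chartAt (Model m) x₀).source) : chartVolume X.gR x₀ K < ⊤ := by
  set e := chartAt (Model m) x₀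
  set ν := (volume.restrict e.target).withDensity (volumeDensity X.gR x₀)
  have hK' : IsCompact (e '' K) := hK.image_of_continuousOn (e.continuousOn.mono hKs)
  have hsub : e '' K ⊆ e.target := by
    rintro _ ⟨x, hx, rfl⟩
    exact e.map_source (hKs hx)
  have hle : chartVolume X.gR x₀ K ≤ ν (e '' K) + ν e.targetᶜ := by
    rw [chartVolume, Measure.map_apply_of_aemeasurable (aemeasurable_chart_symm _ x₀)
      hK.isClosed.measurableSet]
    refine (measure_mono fun y hy => ?_).trans (measure_union_le _ _)
    by_cases hyt : y ∈ e.target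
    · exact Or.inl ⟨e.symm y, hy, e.right_inv hyt⟩
    · exact Or.inr hyt
  have h0 : ν e.targetᶜ = 0 :=
    withDensity_absolutelyContinuous _ _
      (by rw [Measure.restrict_apply e.open_target.measurableSet.compl]; simp)
  refine hle.trans_lt ?_
  rw [h0, add_zero, withDensity_apply _ hK'.measurableSet]
  obtain ⟨B, hB⟩ : ∃ B : ℝ≥0, ∀ y ∈ e '' K, volumeDensity X.gR x₀ y ≤ B := by
    have hc : ContinuousOn (fun y => (volumeDensity X.gR x₀ y).toNNReal) (e '' K) := fun y hy =>
      (ENNReal.tendsto_toNNReal ENNReal.ofReal_ne_top).comp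
        (((continuousOn_volumeDensity X x₀).mono hsub) y hy)
    obtain ⟨B, hB⟩ := (hK'.image_of_continuousOn hc).bddAbove
    refine ⟨B, fun y hy => ?_⟩
    have hne : volumeDensity X.gR x₀ y ≠ ⊤ := ENNReal.ofReal_ne_top
    rw [← ENNReal.coe_toNNReal hne]
    exact ENNReal.coe_le_coe.mpr (hB ⟨y, hy, rfl⟩)
  refine (setLIntegral_mono' hK'.measurableSet hB).trans_lt ?_
  rw [setLIntegral_const]
  refine ENNReal.mul_lt_top ENNReal.coe_lt_top ?_
  exact (Measure.restrict_apply_le _ _).trans_lt hK'.measure_lt_top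

variable [CompactSpace M]

lemma riemannianVolume_eq (q : TangentForm m M) :
    riemannianVolume q = Measure.sum fun x₀ : M =>
      (chartVolume q x₀).withDensity fun x => ENNReal.ofReal (chartPartition m M x₀ x) := rfl

/-- A compact Riemannian manifold has finite volume. -/
lemma riemannianVolume_univ_lt_top : riemannianVolume X.gR Set.univ < ⊤ := by
  rw [riemannianVolume_eq, Measure.sum_apply _ MeasurableSet.univ]
  have hfin := (chartPartition m M).locallyFinite.finite_nonempty_of_compact
  -- By compactness only finitely many functions of the partition of unity are not zero.
  rw [tsum_eq_sum (s := hfin.toFinset)]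
  · refine ENNReal.sum_lt_top.mpr fun x₀ _ => ?_
    have hsub : tsupport (chartPartition m M x₀) ⊆ (chartAt (Model m) x₀).source :=
      (SmoothPartitionOfUnity.exists_isSubordinate_chartAt_source (𝓡 (2 * m)) M).choose_spec x₀
    have hcomp : IsCompact (tsupport (chartPartition m M x₀)) :=
      (isClosed_tsupport _).isCompact
    rw [withDensity_apply _ MeasurableSet.univ, Measure.restrict_univ]
    refine lt_of_le_of_lt (lintegral_mono (g := (tsupport (chartPartition m M x₀)).indicator 1)
      fun x => ?_) ?_
    · by_cases hx : x ∈ tsupport (chartPartition m M x₀)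
      · rw [Set.indicator_of_mem hx]
        exact ENNReal.ofReal_le_one.mpr ((chartPartition m M).le_one x₀ x)
      · simp [image_eq_zero_of_notMem_tsupport hx]
    · rw [lintegral_indicator_one (isClosed_tsupport _).measurableSet]
      exact chartVolume_lt_top_of_isCompact X x₀ hcomp hsub
  · intro x₀ hx₀
    have h0 : ∀ x, chartPartition m M x₀ x = 0 := by
      intro x
      by_contra h
      exact hx₀ (hfin.mem_toFinset.mpr ⟨x, h⟩)
    simp [h0]

lemma riemannianVolume_pos_of_isOpen {V : Set M} (hV : IsOpen V) {p : M} (hp : p ∈ V) :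
    0 < riemannianVolume X.gR V := by
  obtain ⟨x₀, hx₀⟩ := (chartPartition m M).exists_pos_of_mem (Set.mem_univ p)
  have hsub : tsupport (chartPartition m M x₀) ⊆ (chartAt (Model m) x₀).source :=
    (SmoothPartitionOfUnity.exists_isSubordinate_chartAt_source (𝓡 (2 * m)) M).choose_spec x₀
  have hps : p ∈ (chartAt (Model m) x₀).source := hsub (subset_tsupport _ hx₀.ne')
  obtain ⟨c, hc0, hc⟩ := exists_between hx₀
  set W := V ∩ chartPartition m M x₀ ⁻¹' Set.Ioi c
  have hW : IsOpen W := hV.inter (isOpen_Ioi.preimage (chartPartition m M x₀).contMDiff.continuous)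
  have hpW : p ∈ W := ⟨hp, hc⟩
  rw [riemannianVolume_eq]
  refine lt_of_lt_of_le ?_ (Measure.le_sum _ x₀ V)
  refine lt_of_lt_of_le ?_ (measure_mono (Set.inter_subset_left : W ⊆ V))
  rw [withDensity_apply _ hW.measurableSet]
  refine lt_of_lt_of_le ?_ (setLIntegral_mono' (f := fun _ => ENNReal.ofReal c) hW.measurableSet
    fun y hy => ENNReal.ofReal_le_ofReal (le_of_lt hy.2))
  rw [setLIntegral_const]
  exact ENNReal.mul_pos (ENNReal.ofReal_pos.mpr hc0).ne'
    (chartVolume_pos_of_isOpen X x₀ hW hpW hps).ne'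

end Volume

/-! ### Commutators of Dirac operators with the doubled algebra -/

section Leibniz

variable {m : ℕ} {M : Type*} [TopologicalSpace M] [ChartedSpace (Model m) M]

lemma hasMFDerivAt_smul_act {c : M → ℂ} {ψ : M → SpinorSpace m} {x : M}
    {c' : Model m →L[ℝ] ℂ} {ψ' : Model m →L[ℝ] SpinorSpace m}
    (hc : HasMFDerivAt (𝓡 (2 * m)) 𝓘(ℝ, ℂ) c x c')
    (hψ : HasMFDerivAt (𝓡 (2 * m)) 𝓘(ℝ, SpinorSpace m) ψ x ψ') (A : SpinorMatrix m) :
    HasMFDerivAt (𝓡 (2 * m)) 𝓘(ℝ, SpinorSpace m) (fun y => c y • act A (ψ y)) x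
      (c x • (((Matrix.toEuclideanLin A).toContinuousLinearMap.restrictScalars ℝ).comp ψ') +
        c'.smulRight (act A (ψ x)) : Model m →L[ℝ] SpinorSpace m) := by
  set A' : SpinorSpace m →L[ℝ] SpinorSpace m :=
    (Matrix.toEuclideanLin A).toContinuousLinearMap.restrictScalars ℝ
  refine ⟨hc.1.smul (A'.continuous.continuousAt.comp hψ.1), ?_⟩
  have h3 := A'.hasFDerivAt.comp_hasFDerivWithinAt _ hψ.2
  have h4 := HasFDerivWithinAt.smul hc.2 h3
  simpa only [mfld_simps] using! h4

end Leibniz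

namespace KreinSpinManifold

section Operators

variable {m n : ℕ} {M : Type*} [TopologicalSpace M] [ChartedSpace (Model m) M]
  [IsManifold (𝓡 (2 * m)) ∞ M] {ι : Type*} (X : KreinSpinManifold m n M ι)

lemma rep_apply (a : DoubledAlgebra m M) (ψ : X.LocalSpinor) (i : ι) (x : M) :
    X.rep a ψ i x = act (chiral X.Γ (a.1 x) (a.2 x)) (ψ i x) := by
  rw [chiral_act, rep]

lemma IsSmoothSpinor.mdifferentiableAt {X : KreinSpinManifold m n M ι} {ψ : X.LocalSpinor}
    (hψ : X.IsSmoothSpinor ψ) {i : ι} {x : M} (hx : x ∈ X.U i) :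
    MDifferentiableAt (𝓡 (2 * m)) 𝓘(ℝ, SpinorSpace m) (ψ i) x :=
  ((hψ.smooth i).contMDiffAt ((X.isOpen_U i).mem_nhds hx)).mdifferentiableAt (by simp)

/-- The Leibniz rule for `π(f, g) ψ`. -/
lemma frameDeriv_rep (a : DoubledAlgebra m M) {ψ : X.LocalSpinor} {i : ι} {x : M}
    (hψ : MDifferentiableAt (𝓡 (2 * m)) 𝓘(ℝ, SpinorSpace m) (ψ i) x) (b : Fin (2 * m)) :
    X.frameDeriv (X.rep a ψ i) i b x
      = act (chiral X.Γ (X.frameDeriv a.1 i b x) (X.frameDeriv a.2 i b x)) (ψ i x)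
        + act (chiral X.Γ (a.1 x) (a.2 x)) (X.frameDeriv (ψ i) i b x) := by
  have h1 := hasMFDerivAt_smul_act
    ((a.1.contMDiff x).mdifferentiableAt (by simp)).hasMFDerivAt hψ.hasMFDerivAt
    ((1 / 2 : ℂ) • (1 + X.Γ))
  have h2 := hasMFDerivAt_smul_act
    ((a.2.contMDiff x).mdifferentiableAt (by simp)).hasMFDerivAt hψ.hasMFDerivAt
    ((1 / 2 : ℂ) • (1 - X.Γ))
  have h := (h1.add h2).mfderiv
  change mfderiv (𝓡 (2 * m)) 𝓘(ℝ, SpinorSpace m) (X.rep a ψ i) x = _ at h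
  rw [frameDeriv, h, chiral_act, chiral_act]
  have e : ∀ p q r s : SpinorSpace m, p + q + (r + s) = q + s + (p + r) := fun p q r s => by abel
  exact e _ _ _ _

variable (q : TangentForm m M) {ε : Fin (2 * m) → ℝ} (G : GammaMatrices m ε)

/-- The zeroth-order part `-(1/4) ∑_{b,c} ω_{abc} γ^b γ^c` of the spin connection along `E_a`. -/
def connMatrix (i : ι) (a : Fin (2 * m)) (x : M) : SpinorMatrix m :=
  ∑ b, ∑ c, (-(X.leviCivita q i x a b c / 4 : ℝ) : ℂ) • (G.γ b * G.γ c)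

lemma dirac_apply (ψ : X.LocalSpinor) (i : ι) (x : M) :
    X.dirac q G ψ i x = -Complex.I • ∑ a, act (G.γ a)
      (X.frameDeriv (ψ i) i a x + act (X.connMatrix q G i a x) (ψ i x)) := rfl

/-- The matrix `-i ∑_b γ^b (E_b(f) p₊ + E_b(g) p₋)` of the twisted commutator of a Dirac operator
with `(f, g)`. -/
def gradMatrix (a : DoubledAlgebra m M) (i : ι) (x : M) : SpinorMatrix m :=
  -Complex.I • ∑ b, G.γ b * chiral X.Γ (X.frameDeriv a.1 i b x) (X.frameDeriv a.2 i b x)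

variable {G}

lemma connMatrix_mul_chiral (hG : ∀ a, G.γ a * X.Γ = -(X.Γ * G.γ a)) (i : ι)
    (a : Fin (2 * m)) (x : M) (z w : ℂ) :
    X.connMatrix q G i a x * chiral X.Γ z w = chiral X.Γ z w * X.connMatrix q G i a x := by
  simp only [connMatrix, Finset.sum_mul, Finset.mul_sum, smul_mul_assoc, mul_smul_comm]
  refine Finset.sum_congr rfl fun b _ => Finset.sum_congr rfl fun c _ => ?_
  rw [mul_assoc, mul_chiral_of_anticomm (hG c), ← mul_assoc, mul_chiral_of_anticomm (hG b),
    mul_assoc]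

end Operators

end KreinSpinManifold

namespace KreinSpinManifold

section Commutators

variable {m n : ℕ} {M : Type*} [TopologicalSpace M] [ChartedSpace (Model m) M]
  [IsManifold (𝓡 (2 * m)) ∞ M] {ι : Type*} (X : KreinSpinManifold m n M ι)
  (q : TangentForm m M) {ε : Fin (2 * m) → ℝ} {G : GammaMatrices m ε}

/-- A Dirac operator is odd, so moving it past `π(f, g)` exchanges `f` and `g`, up to a term of
order zero. -/
lemma dirac_rep (hG : ∀ a, G.γ a * X.Γ = -(X.Γ * G.γ a)) (a : DoubledAlgebra m M)
    {ψ : X.LocalSpinor} {i : ι} {x : M}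
    (hψ : MDifferentiableAt (𝓡 (2 * m)) 𝓘(ℝ, SpinorSpace m) (ψ i) x) :
    X.dirac q G (X.rep a ψ) i x = act (X.gradMatrix G a i x) (ψ i x)
      + act (chiral X.Γ (a.2 x) (a.1 x)) (X.dirac q G ψ i x) := by
  rw [dirac_apply, dirac_apply, gradMatrix, smul_act, act_smul, ← smul_add, sum_act, act_sum,
    ← Finset.sum_add_distrib]
  congr 1
  refine Finset.sum_congr rfl fun b _ => ?_
  rw [X.frameDeriv_rep a hψ, rep_apply, ← mul_act (X.connMatrix q G i b x),
    X.connMatrix_mul_chiral q hG, mul_act (chiral _ _ _), add_assoc, ← act_add, act_add (G.γ b),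
    ← mul_act, ← mul_act (G.γ b) (chiral _ _ _), mul_chiral_of_anticomm (hG b),
    mul_chiral_of_anticomm (hG b), mul_act (chiral _ _ _), mul_act (chiral _ _ _)]

lemma twistedComm_dirac_apply (hG : ∀ a, G.γ a * X.Γ = -(X.Γ * G.γ a)) (a : DoubledAlgebra m M)
    {ψ : X.LocalSpinor} {i : ι} {x : M}
    (hψ : MDifferentiableAt (𝓡 (2 * m)) 𝓘(ℝ, SpinorSpace m) (ψ i) x) :
    X.twistedComm (X.dirac q G) a ψ i x = act (X.gradMatrix G a i x) (ψ i x) := by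
  change X.dirac q G (X.rep a ψ) i x - X.rep (twist a) (X.dirac q G ψ) i x = _
  rw [X.dirac_rep q hG a hψ, rep_apply]
  exact add_sub_cancel_right _ _

lemma comm_dirac_apply (hG : ∀ a, G.γ a * X.Γ = -(X.Γ * G.γ a)) (a : DoubledAlgebra m M)
    {ψ : X.LocalSpinor} {i : ι} {x : M}
    (hψ : MDifferentiableAt (𝓡 (2 * m)) 𝓘(ℝ, SpinorSpace m) (ψ i) x) :
    X.comm (X.dirac q G) a ψ i x = act (X.gradMatrix G a i x) (ψ i x)
      + (a.2 x - a.1 x) • act X.Γ (X.dirac q G ψ i x) := by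
  change X.dirac q G (X.rep a ψ) i x - X.rep a (X.dirac q G ψ) i x = _
  rw [X.dirac_rep q hG a hψ, rep_apply, add_sub_assoc, ← sub_act, chiral_sub_swap, smul_act]

variable [CompactSpace M]

lemma exists_norm_act_gradMatrix_le (a : DoubledAlgebra m M) :
    ∃ C : ℝ, ∀ i, ∀ x ∈ X.U i, ∀ v, ‖act (X.gradMatrix G a i x) v‖ ≤ C * ‖v‖ := by
  obtain ⟨C₁, h₁, hC₁⟩ := X.exists_norm_mfderiv_frame_le a.1.contMDiff
  obtain ⟨C₂, h₂, hC₂⟩ := X.exists_norm_mfderiv_frame_le a.2.contMDiff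
  obtain ⟨P, hP, hPv⟩ := exists_norm_act_le ((1 / 2 : ℂ) • (1 + X.Γ))
  obtain ⟨Q, hQ, hQv⟩ := exists_norm_act_le ((1 / 2 : ℂ) • (1 - X.Γ))
  refine ⟨∑ _b : Fin (2 * m), (C₁ * P + C₂ * Q), fun i x hx v => ?_⟩
  rw [gradMatrix, smul_act, norm_smul, norm_neg, Complex.norm_I, one_mul, sum_act, Finset.sum_mul]
  refine (norm_sum_le _ _).trans (Finset.sum_le_sum fun b _ => ?_)
  rw [mul_act, norm_act_of_mem_unitary (G.conjTranspose_mul_self b), chiral_act]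
  refine (norm_add_le _ _).trans ?_
  rw [norm_smul, norm_smul, add_mul, mul_assoc, mul_assoc]
  exact add_le_add (mul_le_mul (hC₁ i x hx b) (hPv v) (norm_nonneg _) h₁)
    (mul_le_mul (hC₂ i x hx b) (hQv v) (norm_nonneg _) h₂)

variable [T2Space M] [MeasurableSpace M] [BorelSpace M]

lemma isBoundedOp_of_norm_le {T : X.LocalSpinor → X.LocalSpinor} {C : ℝ}
    (hT : ∀ ψ, X.IsSmoothSpinor ψ → ∀ i, ∀ x ∈ X.U i, ‖T ψ i x‖ ≤ C * ‖ψ i x‖) :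
    X.IsBoundedOp T := by
  refine ⟨C.toNNReal, fun ψ hψ => ?_⟩
  have hpt : ∀ x, X.fibreNorm (T ψ) x ≤ C.toNNReal * X.fibreNorm ψ x := fun x => by
    refine iSup₂_le fun i hi => ?_
    calc ‖T ψ i x‖ₑ = ENNReal.ofReal ‖T ψ i x‖ := (ofReal_norm _).symm
      _ ≤ ENNReal.ofReal (C.toNNReal * ‖ψ i x‖) := ENNReal.ofReal_le_ofReal <|
          (hT ψ hψ i x hi).trans
            (mul_le_mul_of_nonneg_right (Real.le_coe_toNNReal C) (norm_nonneg _))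
      _ = C.toNNReal * ‖ψ i x‖ₑ := by
          rw [ENNReal.ofReal_mul C.toNNReal.coe_nonneg, ENNReal.ofReal_coe_nnreal, ofReal_norm]
      _ ≤ C.toNNReal * X.fibreNorm ψ x :=
          mul_le_mul_right (le_iSup₂ (f := fun i (_ : x ∈ X.U i) => ‖ψ i x‖ₑ) i hi) _
  have hint : ∫⁻ x, X.fibreNorm (T ψ) x ^ 2 ∂(riemannianVolume X.gR)
      ≤ (C.toNNReal : ℝ≥0∞) ^ 2 * ∫⁻ x, X.fibreNorm ψ x ^ 2 ∂(riemannianVolume X.gR) := by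
    rw [← lintegral_const_mul' _ _ (by simp)]
    refine lintegral_mono fun x => ?_
    rw [← mul_pow]
    exact pow_le_pow_left' (hpt x) 2
  refine (ENNReal.rpow_le_rpow hint (by norm_num)).trans_eq ?_
  rw [ENNReal.mul_rpow_of_nonneg _ _ (by norm_num), ← ENNReal.rpow_natCast, ← ENNReal.rpow_mul]
  norm_num
  rfl

theorem isBoundedOp_twistedComm_dirac (hG : ∀ a, G.γ a * X.Γ = -(X.Γ * G.γ a))
    (a : DoubledAlgebra m M) : X.IsBoundedOp (X.twistedComm (X.dirac q G) a) := by
  obtain ⟨C, hC⟩ := X.exists_norm_act_gradMatrix_le (G := G) a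
  refine X.isBoundedOp_of_norm_le (C := C) fun ψ hψ i x hx => ?_
  rw [X.twistedComm_dirac_apply q hG a (hψ.mdifferentiableAt hx)]
  exact hC i x hx _

/-- Composition with a constant unitary matrix does not affect boundedness. -/
lemma isBoundedOp_matrixOp_iff {K : SpinorMatrix m} (hK : Kᴴ * K = 1)
    (T : X.LocalSpinor → X.LocalSpinor) :
    X.IsBoundedOp (fun ψ => X.matrixOp K (T ψ)) ↔ X.IsBoundedOp T := by
  have h : ∀ ψ : X.LocalSpinor, X.l2Norm (X.matrixOp K ψ) = X.l2Norm ψ := fun ψ => by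
    have : ∀ x, X.fibreNorm (X.matrixOp K ψ) x = X.fibreNorm ψ x := fun x => by
      simp only [fibreNorm, matrixOp, ← ofReal_norm, norm_act_of_mem_unitary hK]
    simp only [l2Norm, this]
  simp only [IsBoundedOp, h]

end Commutators

section Dual

variable {m n : ℕ} {M : Type*} [TopologicalSpace M] [ChartedSpace (Model m) M]
  [IsManifold (𝓡 (2 * m)) ∞ M] {ι : Type*} (X : KreinSpinManifold m n M ι)

lemma matrixOp_rep {K : SpinorMatrix m} (hK : K * X.Γ = -(X.Γ * K)) (a : DoubledAlgebra m M)
    (ψ : X.LocalSpinor) : X.matrixOp K (X.rep a ψ) = X.rep (twist a) (X.matrixOp K ψ) := by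
  funext i x
  rw [matrixOp, rep_apply, rep_apply, matrixOp, ← mul_act, ← mul_act, mul_chiral_of_anticomm hK]
  rfl

lemma matrixOp_sub (K : SpinorMatrix m) (φ ψ : X.LocalSpinor) :
    X.matrixOp K (φ - ψ) = X.matrixOp K φ - X.matrixOp K ψ := by
  funext i x
  exact act_sub _ _ _

/-- Multiplication by an odd matrix turns twisted commutators into commutators. -/
lemma comm_matrixOp {K : SpinorMatrix m} (hK : K * X.Γ = -(X.Γ * K))
    (T : X.LocalSpinor → X.LocalSpinor) (a : DoubledAlgebra m M) :
    X.comm (fun ψ => X.matrixOp K (T ψ)) a = fun ψ => X.matrixOp K (X.twistedComm T a ψ) := by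
  refine funext fun ψ => ?_
  rw [twistedComm, matrixOp_sub, X.matrixOp_rep hK]
  rfl

lemma twistedComm_matrixOp {K : SpinorMatrix m} (hK : K * X.Γ = -(X.Γ * K))
    (T : X.LocalSpinor → X.LocalSpinor) (a : DoubledAlgebra m M) :
    X.twistedComm (fun ψ => X.matrixOp K (T ψ)) a = fun ψ => X.matrixOp K (X.comm T a ψ) := by
  refine funext fun ψ => ?_
  rw [comm, matrixOp_sub, X.matrixOp_rep hK]
  rfl

lemma comm_eq_twistedComm {a : DoubledAlgebra m M} (ha : twist a = a)
    (T : X.LocalSpinor → X.LocalSpinor) : X.comm T a = X.twistedComm T a := by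
  funext ψ
  rw [comm, twistedComm, ha]

end Dual

end KreinSpinManifold

/-! ### Continuity of the Dirac operators -/

namespace KreinSpinManifold

section Continuity

variable {m n : ℕ} {M : Type*} [TopologicalSpace M] [ChartedSpace (Model m) M]
  [IsManifold (𝓡 (2 * m)) ∞ M] {ι : Type*} (X : KreinSpinManifold m n M ι)

/-- A family of forms that is continuous when evaluated on continuous vector fields. -/
def IsContinuousForm (q : TangentForm m M) : Prop :=
  ∀ (s : Set M) (V W : (x : M) → TangentSpace (𝓡 (2 * m)) x),
    ContinuousOn (fun x => (⟨x, V x⟩ : TangentBundle (𝓡 (2 * m)) M)) s →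
    ContinuousOn (fun x => (⟨x, W x⟩ : TangentBundle (𝓡 (2 * m)) M)) s →
    ContinuousOn (fun x => q x (V x) (W x)) s

lemma isContinuousForm_gR : IsContinuousForm X.gR := fun _ _ _ hV hW => X.continuousOn_gR hV hW

lemma isContinuousForm_gPR : IsContinuousForm X.gPR := fun _ _ _ hV hW => X.continuousOn_gPR hV hW

lemma continuousOn_mlieBracket_frame (i : ι) (a b : Fin (2 * m)) :
    ContinuousOn (fun x => (⟨x, VectorField.mlieBracket (𝓡 (2 * m)) (X.frame i a) (X.frame i b) x⟩ :
      TangentBundle (𝓡 (2 * m)) M)) (X.U i) := by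
  intro x hx
  have hs := (X.isOpen_U i).mem_nhds hx
  have : IsManifold (𝓡 (2 * m)) (minSmoothness ℝ 2) M :=
    IsManifold.of_le (n := ∞) (by simp; exact ENat.LEInfty.out)
  have : IsManifold (𝓡 (2 * m)) (((1 : ℕ∞) : WithTop ℕ∞) + 1) M :=
    IsManifold.of_le (n := ∞) (by norm_num; exact ENat.LEInfty.out)
  have h := ContMDiffAt.mlieBracket_vectorField (m := 0) (n := 1)
    (((X.frame_smooth i a).contMDiffAt hs).of_le (by exact_mod_cast le_top))
    (((X.frame_smooth i b).contMDiffAt hs).of_le (by exact_mod_cast le_top))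
    (by simp)
  exact h.continuousAt.continuousWithinAt

variable {q : TangentForm m M}

lemma continuousOn_leviCivita (hq : IsContinuousForm q) (i : ι) (a b c : Fin (2 * m)) :
    ContinuousOn (fun x => X.leviCivita q i x a b c) (X.U i) :=
  (((hq _ _ _ (X.continuousOn_mlieBracket_frame i a b) (X.continuousOn_frame i c)).sub
    (hq _ _ _ (X.continuousOn_mlieBracket_frame i b c) (X.continuousOn_frame i a))).add
    (hq _ _ _ (X.continuousOn_mlieBracket_frame i c a) (X.continuousOn_frame i b))).div_const 2

lemma continuousOn_frameDeriv {F : Type*} [NormedAddCommGroup F] [NormedSpace ℝ F] {f : M → F}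
    {i : ι} (hf : ContMDiffOn (𝓡 (2 * m)) 𝓘(ℝ, F) ∞ f (X.U i)) (a : Fin (2 * m)) :
    ContinuousOn (X.frameDeriv f i a) (X.U i) :=
  continuousOn_mfderiv_apply (X.isOpen_U i) hf (X.continuousOn_frame i a)

variable {ε : Fin (2 * m) → ℝ} (G : GammaMatrices m ε)

lemma continuousOn_connMatrix (hq : IsContinuousForm q) (i : ι) (a : Fin (2 * m)) :
    ContinuousOn (X.connMatrix q G i a) (X.U i) :=
  continuousOn_finsetSum _ fun b _ => continuousOn_finsetSum _ fun c _ =>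
    ContinuousOn.smul (Complex.continuous_ofReal.comp_continuousOn
      ((X.continuousOn_leviCivita hq i a b c).div_const 4)).neg continuousOn_const

lemma continuousOn_dirac (hq : IsContinuousForm q) {ψ : X.LocalSpinor} (hψ : X.IsSmoothSpinor ψ)
    (i : ι) : ContinuousOn (X.dirac q G ψ i) (X.U i) :=
  (continuousOn_finsetSum _ fun a _ => continuousOn_act continuousOn_const
    ((X.continuousOn_frameDeriv (hψ.smooth i) a).add
      (continuousOn_act (X.continuousOn_connMatrix G hq i a) (hψ.smooth i).continuousOn))).const_smul
    (-Complex.I)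

lemma continuousOn_rep (a : DoubledAlgebra m M) {ψ : X.LocalSpinor} {i : ι}
    (hψ : ContinuousOn (ψ i) (X.U i)) : ContinuousOn (X.rep a ψ i) (X.U i) :=
  (a.1.contMDiff.continuous.continuousOn.smul (continuousOn_act continuousOn_const hψ)).add
    (a.2.contMDiff.continuous.continuousOn.smul (continuousOn_act continuousOn_const hψ))

end Continuity

/-! ### Localized spinors with a rapidly oscillating phase -/

section Phase

variable {m : ℕ} {M : Type*} [TopologicalSpace M] [ChartedSpace (Model m) M]

/-- The smooth function `e^{itφ}`. -/
def phase {φ : M → ℝ} (hφ : ContMDiff (𝓡 (2 * m)) 𝓘(ℝ, ℝ) ∞ φ) (t : ℝ) :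
    C^∞⟮𝓡 (2 * m), M; 𝓘(ℝ, ℂ), ℂ⟯ :=
  ⟨fun x => Complex.exp ((t * φ x : ℝ) * Complex.I), by
    have h : ContDiff ℝ ∞ fun s : ℝ => Complex.exp ((t * s : ℝ) * Complex.I) := by
      refine Complex.contDiff_exp.comp (ContDiff.mul ?_ contDiff_const)
      exact Complex.ofRealCLM.contDiff.comp (contDiff_const.mul contDiff_id)
    exact h.contMDiff.comp hφ⟩

lemma phase_apply {φ : M → ℝ} (hφ : ContMDiff (𝓡 (2 * m)) 𝓘(ℝ, ℝ) ∞ φ) (t : ℝ) (x : M) :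
    phase hφ t x = Complex.exp ((t * φ x : ℝ) * Complex.I) := rfl

lemma norm_phase {φ : M → ℝ} (hφ : ContMDiff (𝓡 (2 * m)) 𝓘(ℝ, ℝ) ∞ φ) (t : ℝ) (x : M) :
    ‖phase hφ t x‖ = 1 := by
  rw [phase_apply, Complex.norm_exp_ofReal_mul_I]

end Phase

section TestSpinors

variable {m n : ℕ} {M : Type*} [TopologicalSpace M] [ChartedSpace (Model m) M]
  [IsManifold (𝓡 (2 * m)) ∞ M] {ι : Type*} (X : KreinSpinManifold m n M ι)

open Classical in
/-- The section that equals `χ v` in the `i₀`-th spin frame and vanishes outside `U_{i₀}`. -/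
def cutoffSpinor (i₀ : ι) (χ : M → ℝ) (v : SpinorSpace m) : X.LocalSpinor := fun j x =>
  if x ∈ X.U i₀ then (χ x : ℂ) • act (X.trans j i₀ x) v else 0

lemma contMDiffOn_act_trans (i j : ι) (v : SpinorSpace m) :
    ContMDiffOn (𝓡 (2 * m)) 𝓘(ℝ, SpinorSpace m) ∞ (fun x => act (X.trans i j x) v)
      (X.U i ∩ X.U j) := by
  have h : ∀ A : SpinorMatrix m, act A v
      = ∑ k, ∑ l, A k l • act (Matrix.single k l (1 : ℂ)) v := fun A => by
    conv_lhs => rw [Matrix.matrix_eq_sum_single A]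
    simp only [sum_act, ← smul_act, Matrix.smul_single, smul_eq_mul, mul_one]
  simp only [h (X.trans i j _)]
  refine contMDiffOn_finsetSum fun k _ => contMDiffOn_finsetSum fun l _ => ?_
  have hs : ContDiff ℝ ∞ fun z : ℂ => z • act (Matrix.single k l (1 : ℂ)) v :=
    contDiff_id.smul contDiff_const
  exact hs.contMDiff.comp_contMDiffOn (X.trans_smooth i j k l)

lemma isSmoothSpinor_cutoffSpinor {i₀ : ι} {χ : M → ℝ} (hχ : ContMDiff (𝓡 (2 * m)) 𝓘(ℝ, ℝ) ∞ χ)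
    {t : Set M} (ht : IsClosed t) (htU : t ⊆ X.U i₀) (hχt : ∀ x ∉ t, χ x = 0) (v : SpinorSpace m) :
    X.IsSmoothSpinor (X.cutoffSpinor i₀ χ v) := by
  constructor
  · intro j x hx
    apply ContMDiffAt.contMDiffWithinAt
    by_cases h0 : x ∈ X.U i₀
    · have hn : X.U j ∩ X.U i₀ ∈ nhds x :=
        Filter.inter_mem ((X.isOpen_U j).mem_nhds hx) ((X.isOpen_U i₀).mem_nhds h0)
      have h1 : ContMDiffAt (𝓡 (2 * m)) 𝓘(ℝ, SpinorSpace m) ∞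
          (fun y => χ y • act (X.trans j i₀ y) v) x :=
        hχ.contMDiffAt.smul ((X.contMDiffOn_act_trans j i₀ v).contMDiffAt hn)
      refine h1.congr_of_eventuallyEq ?_
      filter_upwards [(X.isOpen_U i₀).mem_nhds h0] with y hy
      simp only [cutoffSpinor, if_pos hy, Complex.coe_smul]
    · have h1 : ContMDiffAt (𝓡 (2 * m)) 𝓘(ℝ, SpinorSpace m) ∞
          (fun _ : M => (0 : SpinorSpace m)) x := contMDiffAt_const
      refine h1.congr_of_eventuallyEq ?_
      filter_upwards [ht.isOpen_compl.mem_nhds fun h => h0 (htU h)] with y hy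
      simp [cutoffSpinor, hχt y hy]
  · rintro i j x ⟨hi, hj⟩
    by_cases h0 : x ∈ X.U i₀
    · simp only [cutoffSpinor, if_pos h0, act_smul, ← mul_act,
        X.trans_cocycle i j i₀ x ⟨⟨hi, hj⟩, h0⟩]
    · simp only [cutoffSpinor, if_neg h0, act_zero]

lemma cutoffSpinor_self {i₀ : ι} {χ : M → ℝ} {v : SpinorSpace m} {x : M} (hx : x ∈ X.U i₀) :
    X.cutoffSpinor i₀ χ v i₀ x = (χ x : ℂ) • v := by
  simp only [cutoffSpinor, if_pos hx, X.trans_self i₀ x hx, one_act]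

lemma norm_cutoffSpinor_le {i₀ j : ι} {χ : M → ℝ} (hχ : ∀ x, χ x ∈ Set.Icc (0 : ℝ) 1)
    {v : SpinorSpace m} {x : M} (hx : x ∈ X.U j) : ‖X.cutoffSpinor i₀ χ v j x‖ ≤ ‖v‖ := by
  unfold cutoffSpinor
  split_ifs with h0
  · rw [norm_smul, norm_act_of_mem_unitary
      (conjTranspose_mul_self_of_mem_spinGroup X.gammaR (X.trans_mem_R j i₀ x ⟨hx, h0⟩)),
      Complex.norm_real, Real.norm_of_nonneg (hχ x).1]
    exact mul_le_of_le_one_left (norm_nonneg _) (hχ x).2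
  · simp

lemma frameDeriv_phase {φ : M → ℝ} (hφ : ContMDiff (𝓡 (2 * m)) 𝓘(ℝ, ℝ) ∞ φ) (t : ℝ) (i : ι)
    (b : Fin (2 * m)) (x : M) :
    X.frameDeriv (phase hφ t) i b x
      = phase hφ t x * (((t * X.frameDeriv φ i b x : ℝ) : ℂ) * Complex.I) := by
  have h1 : HasDerivAt (fun s : ℝ => Complex.exp ((t * s : ℝ) * Complex.I))
      (Complex.exp ((t * φ x : ℝ) * Complex.I) * ((t : ℂ) * Complex.I)) (φ x) := by
    have : HasDerivAt (fun s : ℝ => ((t * s : ℝ) : ℂ) * Complex.I) ((t : ℂ) * Complex.I) (φ x) := by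
      have := (((hasDerivAt_id (φ x)).const_mul t).ofReal_comp).mul_const Complex.I
      simpa using this
    exact this.cexp
  have h2 := h1.hasFDerivAt.hasMFDerivAt.comp x
    ((hφ x).mdifferentiableAt (by simp)).hasMFDerivAt
  have h3 := h2.mfderiv
  change mfderiv (𝓡 (2 * m)) 𝓘(ℝ, ℂ) (phase hφ t) x = _ at h3
  rw [frameDeriv, h3, phase_apply]
  change (X.frameDeriv φ i b x) • (Complex.exp ((t * φ x : ℝ) * Complex.I) *
    ((t : ℂ) * Complex.I)) = _
  rw [Complex.real_smul]
  push_cast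
  ring

lemma rep_diag (c : C^∞⟮𝓡 (2 * m), M; 𝓘(ℝ, ℂ), ℂ⟯) (ψ : X.LocalSpinor) (i : ι) (x : M) :
    X.rep (c, c) ψ i x = c x • ψ i x := by
  rw [rep_apply, chiral_self, smul_act, one_act]

lemma trans_mul_chiral {i j : ι} {x : M} (hx : x ∈ X.U i ∩ X.U j) (z w : ℂ) :
    X.trans i j x * chiral X.Γ z w = chiral X.Γ z w * X.trans i j x :=
  mul_chiral_of_comm (mul_gradingR_of_mem_spinGroup X.gammaR (X.trans_mem_R i j x hx)) z w

lemma isSmoothSpinor_rep (a : DoubledAlgebra m M) {ψ : X.LocalSpinor}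
    (hψ : X.IsSmoothSpinor ψ) : X.IsSmoothSpinor (X.rep a ψ) := by
  constructor
  · intro i
    have hs : ∀ A : SpinorMatrix m, ContDiff ℝ ∞ fun p : ℂ × SpinorSpace m => p.1 • act A p.2 :=
      fun A => contDiff_fst.smul
        (((Matrix.toEuclideanLin A).toContinuousLinearMap.restrictScalars ℝ).contDiff.comp
          contDiff_snd)
    exact ((hs _).contMDiff.comp_contMDiffOn
        (a.1.contMDiff.contMDiffOn.prodMk_space (hψ.smooth i))).add
      ((hs _).contMDiff.comp_contMDiffOn
        (a.2.contMDiff.contMDiffOn.prodMk_space (hψ.smooth i)))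
  · intro i j x hx
    rw [rep_apply, rep_apply, hψ.compat i j x hx, ← mul_act, ← mul_act, X.trans_mul_chiral hx]

variable (q : TangentForm m M) {ε : Fin (2 * m) → ℝ} {G : GammaMatrices m ε}

/-- The phase `e^{itφ}` contributes `t` times the principal symbol at `dφ`, in which the factor
`g - f` appears. -/
lemma comm_dirac_phase (hG : ∀ a, G.γ a * X.Γ = -(X.Γ * G.γ a)) (a : DoubledAlgebra m M)
    {φ : M → ℝ} (hφ : ContMDiff (𝓡 (2 * m)) 𝓘(ℝ, ℝ) ∞ φ) (t : ℝ) {ψ : X.LocalSpinor}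
    (hψ : X.IsSmoothSpinor ψ) {i : ι} {x : M} (hx : x ∈ X.U i) :
    X.comm (X.dirac q G) a (X.rep (phase hφ t, phase hφ t) ψ) i x
      = phase hφ t x • (X.comm (X.dirac q G) a ψ i x + ((t : ℂ) * (a.2 x - a.1 x)) •
        act X.Γ (act (G.slash fun b => X.frameDeriv φ i b x) (ψ i x))) := by
  have hgrad : X.gradMatrix G (phase hφ t, phase hφ t) i x
      = ((t : ℂ) * phase hφ t x) • G.slash fun b => X.frameDeriv φ i b x := by
    simp only [gradMatrix, chiral_self, X.frameDeriv_phase hφ, mul_smul_comm, mul_one,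
      GammaMatrices.slash, Finset.smul_sum, smul_smul]
    refine Finset.sum_congr rfl fun b _ => ?_
    congr 1
    push_cast
    -- The factors `-i` of the Dirac operator and `i` of the derivative of the phase cancel.
    linear_combination (-(phase hφ t x) * t * (X.frameDeriv φ i b x : ℝ)) * Complex.I_mul_I
  rw [X.comm_dirac_apply q hG a ((X.isSmoothSpinor_rep _ hψ).mdifferentiableAt hx),
    X.comm_dirac_apply q hG a (hψ.mdifferentiableAt hx),
    X.dirac_rep q hG _ (hψ.mdifferentiableAt hx), hgrad, rep_diag, chiral_self]
  simp only [act_smul, smul_act, one_act, act_add, smul_add, smul_smul]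
  rw [add_assoc, add_comm (_ • act X.Γ (act (G.slash _) _))]
  congr 2
  · congr 1; ring
  · congr 1; ring

/-- Every point has a smooth real function whose derivative along a given frame vector does not
vanish there. -/
lemma exists_frameDeriv_ne_zero [T2Space M] {i : ι} {p : M} (hp : p ∈ X.U i) (b : Fin (2 * m)) :
    ∃ φ : M → ℝ, ContMDiff (𝓡 (2 * m)) 𝓘(ℝ, ℝ) ∞ φ ∧ X.frameDeriv φ i b p ≠ 0 := by
  set e := extChartAt (𝓡 (2 * m)) p
  have hinv := isInvertible_mfderiv_extChartAt (I := 𝓡 (2 * m))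
    (mem_extChartAt_source (I := 𝓡 (2 * m)) p)
  set w : Model m := mfderiv (𝓡 (2 * m)) 𝓘(ℝ, Model m) e p (X.frame i b p)
  have hw0 : w ≠ 0 := fun h => X.frame_ne_zero hp b
    (hinv.injective (h.trans (map_zero (mfderiv (𝓡 (2 * m)) 𝓘(ℝ, Model m) e p)).symm))
  obtain ⟨f⟩ : Nonempty (SmoothBumpFunction (𝓡 (2 * m)) p) := inferInstance
  have he : ContMDiffOn (𝓡 (2 * m)) 𝓘(ℝ, Model m) ∞ e (chartAt (Model m) p).source :=
    contMDiffOn_extChartAt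
  have hφ₀ : ContMDiffOn (𝓡 (2 * m)) 𝓘(ℝ, ℝ) ∞ (fun x => innerSL ℝ w (e x))
      (chartAt (Model m) p).source := (innerSL ℝ w).contMDiff.comp_contMDiffOn he
  refine ⟨_, f.contMDiff_smul hφ₀, ?_⟩
  have heq : (fun x => f x • innerSL ℝ w (e x)) =ᶠ[nhds p] fun x => innerSL ℝ w (e x) := by
    filter_upwards [f.eventuallyEq_one] with x hx
    simp [hx]
  have hd : MDifferentiableAt (𝓡 (2 * m)) 𝓘(ℝ, Model m) e p :=
    (contMDiffAt_extChartAt (n := 1)).mdifferentiableAt (by simp)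
  have h := ((innerSL ℝ w).hasMFDerivAt.comp p hd.hasMFDerivAt).mfderiv
  change mfderiv (𝓡 (2 * m)) 𝓘(ℝ, ℝ) (fun x => innerSL ℝ w (e x)) p = _ at h
  rw [frameDeriv, heq.mfderiv_eq, h]
  change inner ℝ w w ≠ 0
  exact inner_self_ne_zero.mpr hw0

end TestSpinors

end KreinSpinManifold

/-! ### Unboundedness of the untwisted commutators -/

namespace KreinSpinManifold

section Unbounded

variable {m n : ℕ} {M : Type*} [TopologicalSpace M] [ChartedSpace (Model m) M]
  [IsManifold (𝓡 (2 * m)) ∞ M] {ι : Type*} (X : KreinSpinManifold m n M ι)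
  [CompactSpace M] [T2Space M] [MeasurableSpace M] [BorelSpace M]

/-- The lower integral is monotone, so neither this bound nor the next one needs the fibre norm to
be measurable. -/
lemma l2Norm_le_of_norm_le {ψ : X.LocalSpinor} {B : ℝ≥0∞}
    (h : ∀ i, ∀ x ∈ X.U i, ‖ψ i x‖ₑ ≤ B) :
    X.l2Norm ψ ≤ (B ^ 2 * riemannianVolume X.gR Set.univ) ^ (1 / 2 : ℝ) := by
  refine ENNReal.rpow_le_rpow ?_ (by norm_num)
  rw [← lintegral_const]
  exact lintegral_mono fun x => pow_le_pow_left' (iSup₂_le fun i hi => h i x hi) 2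

lemma le_l2Norm_of_le_norm {ψ : X.LocalSpinor} {i : ι} {V : Set M} (hV : IsOpen V)
    (hVU : V ⊆ X.U i) {B : ℝ≥0∞} (h : ∀ x ∈ V, B ≤ ‖ψ i x‖ₑ) :
    B * riemannianVolume X.gR V ^ (1 / 2 : ℝ) ≤ X.l2Norm ψ := by
  have h1 : B ^ 2 * riemannianVolume X.gR V
      ≤ ∫⁻ x, X.fibreNorm ψ x ^ 2 ∂(riemannianVolume X.gR) := by
    rw [← setLIntegral_const]
    refine (setLIntegral_mono' hV.measurableSet fun x hx => ?_).trans (setLIntegral_le_lintegral V _)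
    exact pow_le_pow_left'
      ((h x hx).trans (le_iSup₂ (f := fun j (_ : x ∈ X.U j) => ‖ψ j x‖ₑ) i (hVU hx))) 2
  refine le_trans (le_of_eq ?_) (ENNReal.rpow_le_rpow h1 (by norm_num : (0 : ℝ) ≤ 1 / 2))
  rw [ENNReal.mul_rpow_of_nonneg _ _ (by norm_num), ← ENNReal.rpow_natCast, ← ENNReal.rpow_mul]
  norm_num

/-- If `f ≠ g`, the commutator of a Dirac operator with `(f, g)` is unbounded: where `f ≠ g` its
principal symbol does not vanish, so it is of order one and grows linearly in `t` on the spinors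
`e^{itφ} ψ`, whose norm does not depend on `t`. -/
theorem not_isBoundedOp_comm_dirac (hm : 0 < 2 * m) {q : TangentForm m M}
    (hq : IsContinuousForm q) {ε : Fin (2 * m) → ℝ} (hε : ∀ a, ε a ≠ 0) {G : GammaMatrices m ε}
    (hG : ∀ a, G.γ a * X.Γ = -(X.Γ * G.γ a)) {a : DoubledAlgebra m M} (ha : twist a ≠ a) :
    ¬ X.IsBoundedOp (X.comm (X.dirac q G) a) := by
  obtain ⟨p, hp⟩ : ∃ p, a.2 p - a.1 p ≠ 0 := by
    by_contra! h
    have h' : a.2 = a.1 := ContMDiffMap.ext fun x => sub_eq_zero.mp (h x)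
    exact ha (Prod.ext h' h'.symm)
  obtain ⟨i, hi⟩ := X.cover p
  -- A phase `φ` and a spinor `v` with `γ(dφ) v ≠ 0` at `p`.
  obtain ⟨φ, hφ, hφp⟩ := X.exists_frameDeriv_ne_zero hi ⟨0, hm⟩
  obtain ⟨v, hv⟩ := exists_act_ne_zero
    (G.slash_ne_zero hε (u := fun b => X.frameDeriv φ i b p) (b := ⟨0, hm⟩) hφp)
  -- A section `ψ` that equals `v` at `p` and is supported in `U i`.
  obtain ⟨t, ht, htc, htU⟩ := exists_mem_nhds_isClosed_subset ((X.isOpen_U i).mem_nhds hi)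
  obtain ⟨χ, hχ1, hχ0, hχ⟩ := exists_contMDiffMap_one_nhds_of_subset_interior (𝓡 (2 * m)) (n := ⊤)
    (isClosed_singleton (x := p)) (Set.singleton_subset_iff.mpr (mem_interior_iff_mem_nhds.mpr ht))
  have hχp : χ p = 1 := by
    rw [nhdsSet_singleton] at hχ1
    exact hχ1.self_of_nhds
  set ψ := X.cutoffSpinor i χ v with hψdef
  have hψ : X.IsSmoothSpinor ψ := X.isSmoothSpinor_cutoffSpinor χ.contMDiff htc htU hχ0 v
  have hψp : ψ i p = v := by
    rw [hψdef, X.cutoffSpinor_self hi, hχp]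
    simp
  set S : M → ℝ := fun x => ‖a.2 x - a.1 x‖ *
    ‖act (G.slash fun b => X.frameDeriv φ i b x) (ψ i x)‖
  set R : M → ℝ := fun x => ‖X.comm (X.dirac q G) a ψ i x‖
  have hUn := (X.isOpen_U i).mem_nhds hi
  have hS : ContinuousAt S p := by
    refine ContinuousAt.mul
      (a.2.contMDiff.continuous.sub a.1.contMDiff.continuous).norm.continuousAt ?_
    refine ((continuousOn_act ?_ (hψ.smooth i).continuousOn).continuousAt hUn).norm
    exact continuousOn_finsetSum _ fun b _ => (Complex.continuous_ofReal.comp_continuousOn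
      (X.continuousOn_frameDeriv hφ.contMDiffOn b)).smul continuousOn_const
  have hR : ContinuousAt R p := by
    have h1 : ContinuousOn (X.comm (X.dirac q G) a ψ i) (X.U i) := by
      have hrep : X.IsSmoothSpinor (X.rep a ψ) := X.isSmoothSpinor_rep a hψ
      exact (X.continuousOn_dirac G hq hrep i).sub
        (X.continuousOn_rep a (X.continuousOn_dirac G hq hψ i))
    exact (h1.continuousAt hUn).norm
  have hSp : 0 < S p := by
    refine mul_pos (norm_pos_iff.mpr hp) (norm_pos_iff.mpr ?_)
    rw [hψp]
    exact hv
  -- On a neighbourhood `V` of `p` the operator grows at least like `t (S p / 2) - (R p + 1)`.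
  obtain ⟨V, hVsub, hVo, hpV⟩ := mem_nhds_iff.mp <| Filter.inter_mem hUn <|
    Filter.inter_mem (hS.eventually (lt_mem_nhds (half_lt_self hSp)))
      (hR.eventually (gt_mem_nhds (lt_add_one (R p))))
  have hlow : ∀ t : ℝ, 0 ≤ t → ∀ x ∈ V, t * (S p / 2) - (R p + 1)
      ≤ ‖X.comm (X.dirac q G) a (X.rep (phase hφ t, phase hφ t) ψ) i x‖ := by
    intro t ht0 x hx
    obtain ⟨hxU, hxS, hxR⟩ := hVsub hx
    have hxS : S p / 2 < S x := hxS
    have hxR : R x < R p + 1 := hxR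
    have hΓ : X.Γᴴ * X.Γ = 1 := gradingR_conjTranspose_mul_self X.gammaR
    have e : ‖((t : ℂ) * (a.2 x - a.1 x)) •
        act X.Γ (act (G.slash fun b => X.frameDeriv φ i b x) (ψ i x))‖ = t * S x := by
      rw [norm_smul, norm_mul, norm_act_of_mem_unitary hΓ, Complex.norm_real,
        Real.norm_of_nonneg ht0, mul_assoc]
    rw [X.comm_dirac_phase q hG a hφ t hψ hxU, norm_smul, norm_phase, one_mul,
      add_comm (X.comm _ _ _ _ _)]
    have h1 := norm_sub_le_norm_add (((t : ℂ) * (a.2 x - a.1 x)) •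
      act X.Γ (act (G.slash fun b => X.frameDeriv φ i b x) (ψ i x)))
      (X.comm (X.dirac q G) a ψ i x)
    rw [e] at h1
    have h2 : t * (S p / 2) ≤ t * S x := mul_le_mul_of_nonneg_left hxS.le ht0
    exact (sub_le_sub h2 hxR.le).trans h1
  rintro ⟨C, hC⟩
  set A : ℝ≥0∞ := C * (‖v‖ₑ ^ 2 * riemannianVolume X.gR Set.univ) ^ (1 / 2 : ℝ)
  set s : ℝ≥0∞ := riemannianVolume X.gR V ^ (1 / 2 : ℝ)
  have hAtop : A ≠ ⊤ := ENNReal.mul_ne_top ENNReal.coe_ne_top <|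
    ENNReal.rpow_ne_top_of_nonneg (by norm_num) <| ENNReal.mul_ne_top
      (ENNReal.pow_ne_top enorm_ne_top) (riemannianVolume_univ_lt_top X).ne
  have hs0 : s ≠ 0 := (ENNReal.rpow_pos (riemannianVolume_pos_of_isOpen X hVo hpV)
    ((measure_mono (Set.subset_univ V)).trans_lt (riemannianVolume_univ_lt_top X)).ne).ne'
  have hsfin : s ≠ ⊤ := ENNReal.rpow_ne_top_of_nonneg (by norm_num)
    ((measure_mono (Set.subset_univ V)).trans_lt (riemannianVolume_univ_lt_top X)).ne
  -- The frequency is chosen so that the lower bound exceeds `A / s`.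
  set L : ℝ := (A / s).toReal + 1
  set T : ℝ := (L + (R p + 1)) / (S p / 2) with hT
  have hL : 0 < L := by positivity
  have hT0 : 0 ≤ T := div_nonneg (add_nonneg hL.le (add_nonneg (norm_nonneg _) zero_le_one))
    (half_pos hSp).le
  have hTL : T * (S p / 2) - (R p + 1) = L := by
    rw [hT, div_mul_cancel₀ _ (half_pos hSp).ne', add_sub_cancel_right]
  have hup := hC _ (X.isSmoothSpinor_rep (phase hφ T, phase hφ T) hψ)
  have hnorm : X.l2Norm (X.rep (phase hφ T, phase hφ T) ψ)
      ≤ (‖v‖ₑ ^ 2 * riemannianVolume X.gR Set.univ) ^ (1 / 2 : ℝ) := by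
    refine X.l2Norm_le_of_norm_le fun j x hx => ?_
    rw [rep_diag, ← ofReal_norm, ← ofReal_norm, norm_smul, norm_phase, one_mul]
    exact ENNReal.ofReal_le_ofReal (X.norm_cutoffSpinor_le hχ hx)
  have hlo := X.le_l2Norm_of_le_norm (ψ := X.comm (X.dirac q G) a
    (X.rep (phase hφ T, phase hφ T) ψ)) (B := ENNReal.ofReal L) hVo (fun x hx => (hVsub hx).1)
    fun x hx => by
      rw [← ofReal_norm]
      exact ENNReal.ofReal_le_ofReal (hTL.symm.le.trans (hlow T hT0 x hx))
  have hcontra : ENNReal.ofReal L * s ≤ A := (hlo.trans hup).trans (mul_le_mul_right hnorm _)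
  have hLe : ENNReal.ofReal L = A / s + 1 := by
    rw [ENNReal.ofReal_add ENNReal.toReal_nonneg zero_le_one,
      ENNReal.ofReal_toReal (ENNReal.div_ne_top hAtop hs0), ENNReal.ofReal_one]
  rw [hLe, add_mul, one_mul, ENNReal.div_mul_cancel hs0 hsfin] at hcontra
  exact (ENNReal.lt_add_right hAtop hs0).not_ge hcontra

end Unbounded

end KreinSpinManifold

end KreinDirac

end

theorem mainTheorem12 {m n : ℕ} (hn : Odd n) (hnm : n < 2 * m)
    {M : Type*} [TopologicalSpace M] [ChartedSpace (KreinDirac.Model m) M]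
    [IsManifold (𝓡 (2 * m)) ∞ M] [CompactSpace M] [T2Space M]
    [MeasurableSpace M] [BorelSpace M] {ι : Type*}
    (X : KreinDirac.KreinSpinManifold m n M ι) :
    (∀ a : KreinDirac.DoubledAlgebra m M,
      X.IsBoundedOp (X.comm X.hatD₂ a) ∧
      X.IsBoundedOp (X.comm X.hatDK₁ a) ∧
      X.IsBoundedOp (X.twistedComm X.DK₂ a) ∧
      X.IsBoundedOp (X.twistedComm X.D₁ a)) ∧
    (∀ a : KreinDirac.DoubledAlgebra m M, KreinDirac.twist a ≠ a →
      ¬ X.IsBoundedOp (X.twistedComm X.hatD₂ a) ∧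
      ¬ X.IsBoundedOp (X.twistedComm X.hatDK₁ a) ∧
      ¬ X.IsBoundedOp (X.comm X.DK₂ a) ∧
      ¬ X.IsBoundedOp (X.comm X.D₁ a)) ∧
    (∀ a : KreinDirac.DoubledAlgebra m M, KreinDirac.twist a = a →
      X.IsBoundedOp (X.twistedComm X.hatD₂ a) ∧
      X.IsBoundedOp (X.twistedComm X.hatDK₁ a) ∧
      X.IsBoundedOp (X.comm X.DK₂ a) ∧
      X.IsBoundedOp (X.comm X.D₁ a)) := by
  open KreinDirac in
  have hm : 0 < 2 * m := hn.pos.trans hnm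
  have hR : ∀ b, X.gammaR.γ b * X.Γ = -(X.Γ * X.gammaR.γ b) := gradingR_anticomm X.gammaR
  have hPR : ∀ b, X.gammaPR.γ b * X.Γ = -(X.Γ * X.gammaPR.γ b) := fun b => by
    rw [KreinSpinManifold.Γ, X.grading_eq]
    exact gradingPR_anticomm X.gammaPR b
  have hK₁ : X.K₁ᴴ * X.K₁ = 1 := fundSymm_conjTranspose_mul_self X.gammaR n
  have hK₂ : X.K₂ᴴ * X.K₂ = 1 := fundSymm_conjTranspose_mul_self X.gammaPR n
  have hK₁Γ : X.K₁ * X.Γ = -(X.Γ * X.K₁) := fundSymm_anticomm X.gammaR hn hnm hR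
  have hK₂Γ : X.K₂ * X.Γ = -(X.Γ * X.K₂) := fundSymm_anticomm X.gammaPR hn hnm hPR
  have e₁ : ∀ a, X.IsBoundedOp (X.comm X.hatD₂ a) ↔ X.IsBoundedOp (X.twistedComm X.DK₂ a) :=
    fun a => (X.comm_matrixOp hK₂Γ X.DK₂ a).symm ▸ X.isBoundedOp_matrixOp_iff hK₂ _
  have e₂ : ∀ a, X.IsBoundedOp (X.comm X.hatDK₁ a) ↔ X.IsBoundedOp (X.twistedComm X.D₁ a) :=
    fun a => (X.comm_matrixOp hK₁Γ X.D₁ a).symm ▸ X.isBoundedOp_matrixOp_iff hK₁ _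
  have e₃ : ∀ a, X.IsBoundedOp (X.twistedComm X.hatD₂ a) ↔ X.IsBoundedOp (X.comm X.DK₂ a) :=
    fun a => (X.twistedComm_matrixOp hK₂Γ X.DK₂ a).symm ▸ X.isBoundedOp_matrixOp_iff hK₂ _
  have e₄ : ∀ a, X.IsBoundedOp (X.twistedComm X.hatDK₁ a) ↔ X.IsBoundedOp (X.comm X.D₁ a) :=
    fun a => (X.twistedComm_matrixOp hK₁Γ X.D₁ a).symm ▸ X.isBoundedOp_matrixOp_iff hK₁ _
  have b₁ : ∀ a, X.IsBoundedOp (X.twistedComm X.D₁ a) :=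
    X.isBoundedOp_twistedComm_dirac X.gR hR
  have b₂ : ∀ a, X.IsBoundedOp (X.twistedComm X.DK₂ a) :=
    X.isBoundedOp_twistedComm_dirac X.gPR hPR
  simp only [e₁, e₂, e₃, e₄]
  refine ⟨fun a => ⟨b₂ a, b₁ a, b₂ a, b₁ a⟩, fun a ha => ?_, fun a ha => ?_⟩
  · have u₁ : ¬ X.IsBoundedOp (X.comm X.D₁ a) :=
      X.not_isBoundedOp_comm_dirac hm X.isContinuousForm_gR (fun _ => one_ne_zero) hR ha
    have u₂ : ¬ X.IsBoundedOp (X.comm X.DK₂ a) :=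
      X.not_isBoundedOp_comm_dirac hm X.isContinuousForm_gPR
        (fun b => by unfold signPR; split_ifs <;> norm_num) hPR ha
    exact ⟨u₂, u₁, u₂, u₁⟩
  · rw [X.comm_eq_twistedComm ha, X.comm_eq_twistedComm ha]
    exact ⟨b₂ a, b₁ a, b₂ a, b₁ a⟩
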